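/- Let $G$ be a finite irreducible Coxeter group (given by a Coxeter system $(G,\{s_i\}_{i\in B})$ with connected Coxeter graph) which is not of type $BC_n$, $n\ge 2$, and let $\psi:G\times G\to\mathbb C^*$ be a two-cocycle (trivial action of $G$ on $\mathbb C^*$). An element $g\in G$ is called $\psi$-regular if $\psi(g,h)=\psi(h,g)$ for all $h$ in the centralizer of $g$; a reflection of $G$ is a conjugate of some $s_i$. (1) If some reflection of $G$ is $\psi$-regular, then $\psi$ is cohomologous to the trivial cocycle. (2) Let $\mathfrak h$ be the complexified reflection representation of $G$ and $U=\mathfrak h\oplus\mathfrak h^*$ with the symplectic form $\omega((y,x),(y',x'))=x(y')-x'(y)$. Let $S_\psi(G,U)$ be the set of $\psi$-regular $s\in G$ with $\operatorname{rank}(\mathrm{Id}-s)|_U=2$, and for such $s$ let $\omega_s$ be the form on $U$ with radical $\operatorname{Ker}(\mathrm{Id}-s)$ that coincides with $\omega$ on $\operatorname{Im}(\mathrm{Id}-s)$. Let $\mathbb C_\psi G$ be the twisted group algebra, with basis $G$ and product $g\circ_\psi h=\psi(g,h)\,gh$. For $t\in\mathbb C$ and a function $c:S_\psi(G,U)\to\mathbb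 C$ let the twisted rational Cherednik algebra $\mathcal H_{t,c}(G,U,\psi)$ be the quotient of $(TU)\rtimes\mathbb C_\psi G$ by the two-sided ideal generated by $$y\otimes x-x\otimes y-t\,\omega(x,y)\cdot 1-\sum_{s\in S_\psi(G,U)}c(s)\,\omega_s(x,y)\cdot s,\qquad x,y\in U,$$ and let $A_t(U)=TU/(y\otimes x-x\otimes y-t\,\omega(x,y)\cdot 1 : x,y\in U)$ be the Weyl algebra of $(U,t\omega)$. If $\psi$ is not cohomologous to the trivial cocycle, then for all $t$ and $c$ there is an isomorphism of $\mathbb C$-algebras $$\mathcal H_{t,c}(G,U,\psi)\cong A_t(U)\rtimes\mathbb C_\psi G,$$ which is the identity on $U$ and on $G$. In particular, with $SU$ the symmetric algebra of $U$, there is for all $c$ an isomorphism $\mathcal H_{0,c}(G,U,\psi)\cong(SU)\rtimes\mathbb C_\psi G$ which is the identity on $U$ and on $G$. -/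

import Mathlib

noncomputable section

namespace TwistedCherednik

universe u v w

/-! ### Two-cocycles with values in `ℂˣ` (trivial action) -/

/-- A two-cocycle `ψ : G × G → ℂˣ`, the group acting trivially on `ℂˣ`. -/
structure TwoCocycle (G : Type u) [Group G] where
  /-- The underlying function of two variables. -/
  toFun : G → G → ℂˣ
  cocycle : ∀ g h k : G, toFun g h * toFun (g * h) k = toFun h k * toFun g (h * k)

namespace TwoCocycle

variable {G : Type u} [Group G]

instance : CoeFun (TwoCocycle G) fun _ => G → G → ℂˣ := ⟨TwoCocycle.toFun⟩

/-- The trivial cocycle, identically `1`. -/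
def trivial (G : Type u) [Group G] : TwoCocycle G := ⟨fun _ _ => 1, fun _ _ _ => rfl⟩

/-- Two cocycles are cohomologous if they differ by the coboundary of a function `G → ℂˣ`. -/
def Cohomologous (ψ ψ' : TwoCocycle G) : Prop :=
  ∃ φ : G → ℂˣ, ∀ g h : G, ψ g h = ψ' g h * (φ g * φ h * (φ (g * h))⁻¹)

/-- `g` is `ψ`-regular if `ψ(g,h) = ψ(h,g)` for all `h` in the centralizer of `g`. -/
def IsRegular (ψ : TwoCocycle G) (g : G) : Prop :=
  ∀ h ∈ Subgroup.centralizer {g}, ψ g h = ψ h g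

theorem map_one_left (ψ : TwoCocycle G) (g : G) : ψ 1 g = ψ 1 1 := by
  have h := ψ.cocycle 1 1 g
  simp only [one_mul] at h
  rw [mul_comm] at h
  exact (mul_left_cancel h).symm

theorem map_one_right (ψ : TwoCocycle G) (g : G) : ψ g 1 = ψ 1 1 := by
  have h := ψ.cocycle g 1 1
  simp only [mul_one, mul_comm] at h
  exact mul_left_cancel (by rw [h, mul_comm])

end TwoCocycle

/-! ### Twisted semidirect products `A ⋊ ℂ_ψ G` -/

/-- The twisted semidirect product `A ⋊ ℂ_ψ G` of a `ℂ`-algebra `A` on which `G` acts by algebra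
homomorphisms (through `α`) with the twisted group algebra `ℂ_ψ G`. As a vector space it is the space
of finite formal sums `∑ a_g g`; the product is `(a g) (b h) = ψ(g,h) a α_g(b) gh`.
For `A = ℂ` it is the twisted group algebra itself. -/
def TwistedSmash {G : Type u} [Group G] {A : Type v} [Ring A] [Algebra ℂ A]
    (_α : G →* (A →ₐ[ℂ] A)) (_ψ : TwoCocycle G) : Type (max u v) := G →₀ A

namespace TwistedSmash

variable {G : Type u} [Group G] {A : Type v} [Ring A] [Algebra ℂ A]
  (α : G →* (A →ₐ[ℂ] A)) (ψ : TwoCocycle G)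

instance : AddCommGroup (TwistedSmash α ψ) := inferInstanceAs (AddCommGroup (G →₀ A))
instance : Module ℂ (TwistedSmash α ψ) := inferInstanceAs (Module ℂ (G →₀ A))

/-- `single g a` is the element `a g`. -/
def single (g : G) : A →ₗ[ℂ] TwistedSmash α ψ := Finsupp.lsingle (R := ℂ) (M := A) g

/-- Elements are finite sums of elements `a g`. -/
theorem induction {p : TwistedSmash α ψ → Prop} (x : TwistedSmash α ψ) (zero : p 0)
    (add : ∀ x y, p x → p y → p (x + y)) (single : ∀ g a, p (single α ψ g a)) : p x :=
  Finsupp.induction_linear (motive := p) x zero add single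

/-- The linear map out of `A ⋊ ℂ_ψ G` with prescribed values `f g a` on the elements `a g`. -/
def lsum {N : Type w} [AddCommGroup N] [Module ℂ N] (f : G → A →ₗ[ℂ] N) :
    TwistedSmash α ψ →ₗ[ℂ] N := Finsupp.lsum (M := A) ℂ f

theorem lsum_single {N : Type w} [AddCommGroup N] [Module ℂ N] (f : G → A →ₗ[ℂ] N) (g : G)
    (a : A) : lsum α ψ f (single α ψ g a) = f g a :=
  Finsupp.lsum_single (M := A) ℂ f g a

/-- The product of `a g` and `b h`, as a bilinear map in `a` and `b`. -/
def mulSingle (g h : G) : A →ₗ[ℂ] A →ₗ[ℂ] TwistedSmash α ψ :=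
  LinearMap.mk₂ ℂ (fun a b => single α ψ (g * h) ((ψ g h : ℂ) • (a * α g b)))
    (fun a a' b => by rw [add_mul, smul_add, map_add])
    (fun k a b => by rw [smul_mul_assoc, smul_comm, map_smul])
    (fun a b b' => by rw [map_add, mul_add, smul_add, map_add])
    (fun k a b => by simp only [map_smul, mul_smul_comm, smul_comm k])

/-- The product, as a bilinear map. -/
def mulHom : TwistedSmash α ψ →ₗ[ℂ] TwistedSmash α ψ →ₗ[ℂ] TwistedSmash α ψ :=
  lsum α ψ fun g => LinearMap.flip (lsum α ψ fun h => (mulSingle α ψ g h).flip)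

instance : Mul (TwistedSmash α ψ) := ⟨fun x y => mulHom α ψ x y⟩
instance : One (TwistedSmash α ψ) := ⟨single α ψ 1 (((ψ 1 1)⁻¹ : ℂˣ) • (1 : A))⟩

theorem mul_eq (x y : TwistedSmash α ψ) : x * y = mulHom α ψ x y := rfl

theorem one_eq : (1 : TwistedSmash α ψ) = single α ψ 1 (((ψ 1 1)⁻¹ : ℂˣ) • (1 : A)) := rfl

theorem single_mul_single (g h : G) (a b : A) :
    single α ψ g a * single α ψ h b = single α ψ (g * h) ((ψ g h : ℂ) • (a * α g b)) := by
  rw [mul_eq, mulHom, lsum_single, LinearMap.flip_apply, lsum_single]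
  rfl

instance : NonUnitalNonAssocRing (TwistedSmash α ψ) where
  left_distrib x y z := by simp only [mul_eq, map_add]
  right_distrib x y z := by simp only [mul_eq, map_add, LinearMap.add_apply]
  zero_mul x := by simp only [mul_eq, map_zero, LinearMap.zero_apply]
  mul_zero x := by simp only [mul_eq, map_zero]

instance : Ring (TwistedSmash α ψ) where
  __ := (inferInstance : AddCommGroup (TwistedSmash α ψ))
  __ := (inferInstance : NonUnitalNonAssocRing (TwistedSmash α ψ))
  one_mul x := by
    induction x using TwistedSmash.induction with
    | zero => exact mul_zero 1
    | add x y hx hy => rw [mul_add, hx, hy]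
    | single g a =>
      rw [one_eq, single_mul_single, one_mul, ψ.map_one_left, map_one, AlgHom.one_apply,
        smul_mul_assoc, one_mul, Units.smul_def, smul_smul, Units.mul_inv, one_smul]
  mul_one x := by
    induction x using TwistedSmash.induction with
    | zero => exact zero_mul 1
    | add x y hx hy => rw [add_mul, hx, hy]
    | single g a =>
      rw [one_eq, single_mul_single, mul_one, ψ.map_one_right, Units.smul_def,
        AlgHom.map_smul_of_tower, map_one, mul_smul_comm, mul_one, smul_smul, Units.mul_inv,
        one_smul]
  mul_assoc x y z := by
    induction x using TwistedSmash.induction with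
    | zero => simp only [zero_mul]
    | add x x' hx hx' => simp only [add_mul, hx, hx']
    | single g a =>
      induction y using TwistedSmash.induction with
      | zero => simp only [zero_mul, mul_zero]
      | add y y' hy hy' => simp only [add_mul, mul_add, hy, hy']
      | single h b =>
        induction z using TwistedSmash.induction with
        | zero => simp only [mul_zero]
        | add z z' hz hz' => simp only [mul_add, hz, hz']
        | single k c =>
          have hψ : ((ψ g h : ℂˣ) : ℂ) * ψ (g * h) k = ψ h k * ψ g (h * k) := by
            exact_mod_cast congrArg Units.val (ψ.cocycle g h k)
          rw [single_mul_single, single_mul_single, single_mul_single, single_mul_single,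
            mul_assoc g h k]
          refine congrArg (single α ψ (g * (h * k))) ?_
          simp only [map_smul, map_mul, smul_mul_assoc, mul_smul_comm, smul_smul,
            AlgHom.mul_apply, mul_assoc]
          rw [mul_comm ((ψ (g * h) k : ℂˣ) : ℂ), hψ, mul_comm ((ψ h k : ℂˣ) : ℂ)]

instance : Algebra ℂ (TwistedSmash α ψ) :=
  Algebra.ofModule
    (fun k x y => by simp only [mul_eq, map_smul, LinearMap.smul_apply])
    (fun k x y => by simp only [mul_eq, map_smul])

/-- The basis element `g` of the twisted group algebra, as an element of `A ⋊ ℂ_ψ G`. -/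
def of (g : G) : TwistedSmash α ψ := single α ψ g 1

/-- The embedding of `A` into `A ⋊ ℂ_ψ G`, `a ↦ a · 1`; the identity of `ℂ_ψ G` is the group
identity divided by `ψ(1,1)`. -/
def incl : A →ₐ[ℂ] TwistedSmash α ψ :=
  AlgHom.ofLinearMap (single α ψ 1 ∘ₗ LinearMap.lsmul ℂ A (((ψ 1 1)⁻¹ : ℂˣ) : ℂ)) (by
    rfl) (by
    intro a b
    simp only [LinearMap.comp_apply, LinearMap.lsmul_apply]
    rw [single_mul_single, mul_one]
    refine congrArg (single α ψ 1) ?_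
    rw [map_one, AlgHom.one_apply, smul_mul_assoc, mul_smul_comm, smul_smul, smul_smul,
      Units.mul_inv, one_mul])

end TwistedSmash

/-! ### Symplectic representations and twisted symplectic reflection algebras -/

/-- The action of `G` on the tensor algebra induced by a representation. -/
def tensorAction {G : Type u} [Group G] {U : Type v} [AddCommGroup U] [Module ℂ U]
    (ρ : Representation ℂ G U) : G →* (TensorAlgebra ℂ U →ₐ[ℂ] TensorAlgebra ℂ U) where
  toFun g := TensorAlgebra.lift ℂ (TensorAlgebra.ι ℂ ∘ₗ ρ g)
  map_one' := by ext x; simp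
  map_mul' g h := by ext x; simp

/-- The action of `G` on the symmetric algebra induced by a representation. -/
def symAction {G : Type u} [Group G] {U : Type v} [AddCommGroup U] [Module ℂ U]
    (ρ : Representation ℂ G U) : G →* (SymmetricAlgebra ℂ U →ₐ[ℂ] SymmetricAlgebra ℂ U) where
  toFun g := SymmetricAlgebra.lift (SymmetricAlgebra.ι ℂ U ∘ₗ ρ g)
  map_one' := by ext x; simp
  map_mul' g h := by ext x; simp

/-- A finite-dimensional symplectic vector space `(U, ω)` over `ℂ` with a linear action `ρ` of `G`
preserving the symplectic form. -/
structure SymplecticRep (G : Type u) [Group G] (U : Type v) [AddCommGroup U] [Module ℂ U] where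
  /-- The action. -/
  ρ : Representation ℂ G U
  /-- The symplectic form. -/
  ω : LinearMap.BilinForm ℂ U
  finite : Module.Finite ℂ U
  alt : ω.IsAlt
  nondegenerate : ω.Nondegenerate
  invariant : ∀ g x y, ω (ρ g x) (ρ g y) = ω x y

namespace SymplecticRep

variable {G : Type u} [Group G] {U : Type v} [AddCommGroup U] [Module ℂ U]

/-- The endomorphism `Id - g` of `U`. -/
def idSub (V : SymplecticRep G U) (g : G) : U →ₗ[ℂ] U := LinearMap.id - V.ρ g

/-- `S(G,U)`: the elements acting on `U` by symplectic reflections, i.e. `rank (Id - g) = 2`. -/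
def reflections (V : SymplecticRep G U) : Set G :=
  {g | Module.finrank ℂ (LinearMap.range (V.idSub g)) = 2}

/-- `S_ψ(G,U)`: the `ψ`-regular elements of `S(G,U)`. -/
def regularReflections (V : SymplecticRep G U) (ψ : TwoCocycle G) : Set G :=
  {g | g ∈ V.reflections ∧ ψ.IsRegular g}

/-- The decomposition `U = Im (Id - g) ⊕ Ker (Id - g)`. -/
theorem isCompl_range_ker [Finite G] (V : SymplecticRep G U) (g : G) :
    IsCompl (LinearMap.range (V.idSub g)) (LinearMap.ker (V.idSub g)) := by
  have := V.finite
  have hdisj : Disjoint (LinearMap.range (V.idSub g)) (LinearMap.ker (V.idSub g)) := by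
    rw [Submodule.disjoint_def]
    rintro _ ⟨w, rfl⟩ hv
    have hfix : V.ρ g (w - V.ρ g w) = w - V.ρ g w := by
      have := LinearMap.mem_ker.mp hv
      simp only [idSub, LinearMap.sub_apply, LinearMap.id_apply] at this
      rw [sub_eq_zero] at this
      exact this.symm
    have hpow : ∀ k : ℕ, V.ρ (g ^ k) w = w - k • (w - V.ρ g w) := by
      intro k
      induction k with
      | zero => simp
      | succ k ih =>
        rw [pow_succ', map_mul, Module.End.mul_apply, ih, map_sub, map_nsmul, hfix, succ_nsmul]
        abel
    have h := hpow (orderOf g)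
    rw [pow_orderOf_eq_one, map_one, Module.End.one_apply, eq_comm, sub_eq_self,
      ← Nat.cast_smul_eq_nsmul ℂ, smul_eq_zero] at h
    rcases h with h | h
    · exact absurd h (by exact_mod_cast (orderOf_pos g).ne')
    · simpa [idSub] using h
  refine ⟨hdisj, codisjoint_iff.mpr ?_⟩
  apply Submodule.eq_top_of_finrank_eq
  have h1 := Submodule.finrank_sup_add_finrank_inf_eq (LinearMap.range (V.idSub g))
    (LinearMap.ker (V.idSub g))
  rw [hdisj.eq_bot, finrank_bot, add_zero] at h1
  rw [h1, LinearMap.finrank_range_add_finrank_ker]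

/-- `ω_g`: the form with radical `Ker (Id - g)` which coincides with `ω` on `Im (Id - g)`, i.e. the
pull-back of `ω` under the projection onto `Im (Id - g)` along `Ker (Id - g)`. -/
def omegaOf [Finite G] (V : SymplecticRep G U) (g : G) : LinearMap.BilinForm ℂ U :=
  V.ω.compl₁₂ (Submodule.projection _ _ (V.isCompl_range_ker g))
    (Submodule.projection _ _ (V.isCompl_range_ker g))

/-- `(TU) ⋊ ℂ_ψ G`. -/
abbrev TensorSmash (V : SymplecticRep G U) (ψ : TwoCocycle G) : Type (max u v) :=
  TwistedSmash (tensorAction V.ρ) ψ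

/-- `(SU) ⋊ ℂ_ψ G`. -/
abbrev SymSmash (V : SymplecticRep G U) (ψ : TwoCocycle G) : Type (max u v) :=
  TwistedSmash (symAction V.ρ) ψ

/-- The element `y ⊗ x - x ⊗ y - t ω(x,y) 1 - ∑_{s ∈ S_ψ(G,U)} c(s) ω_s(x,y) s` of
`(TU) ⋊ ℂ_ψ G`. -/
def relator [Finite G] (V : SymplecticRep G U) (ψ : TwoCocycle G) (t : ℂ)
    (c : V.regularReflections ψ → ℂ) (x y : U) : V.TensorSmash ψ :=
  TwistedSmash.incl _ _ (TensorAlgebra.ι ℂ y * TensorAlgebra.ι ℂ x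
      - TensorAlgebra.ι ℂ x * TensorAlgebra.ι ℂ y)
    - (t * V.ω x y) • (1 : V.TensorSmash ψ)
    - ∑ᶠ s : V.regularReflections ψ, (c s * V.omegaOf s.1 x y) • TwistedSmash.of _ _ s.1

/-- The relations `relator x y = 0`. -/
inductive Rel [Finite G] (V : SymplecticRep G U) (ψ : TwoCocycle G) (t : ℂ)
    (c : V.regularReflections ψ → ℂ) : V.TensorSmash ψ → V.TensorSmash ψ → Prop
  | intro (x y : U) : Rel V ψ t c (V.relator ψ t c x y) 0

/-- The twisted symplectic reflection algebra `H_{t,c}(G,U,ψ)`: the quotient of `(TU) ⋊ ℂ_ψ G` by the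
two-sided ideal generated by the elements `relator x y`, `x, y ∈ U`. -/
abbrev ReflectionAlgebra [Finite G] (V : SymplecticRep G U) (ψ : TwoCocycle G) (t : ℂ)
    (c : V.regularReflections ψ → ℂ) : Type (max u v) :=
  RingQuot (V.Rel ψ t c)

/-- The quotient map `(TU) ⋊ ℂ_ψ G → H_{t,c}(G,U,ψ)`. -/
def quotMap [Finite G] (V : SymplecticRep G U) (ψ : TwoCocycle G) (t : ℂ)
    (c : V.regularReflections ψ → ℂ) : V.TensorSmash ψ →ₐ[ℂ] V.ReflectionAlgebra ψ t c :=
  RingQuot.mkAlgHom ℂ (V.Rel ψ t c)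

/-- The image of a vector `x ∈ U` in `H_{t,c}(G,U,ψ)`. -/
def vec [Finite G] (V : SymplecticRep G U) (ψ : TwoCocycle G) (t : ℂ)
    (c : V.regularReflections ψ → ℂ) (x : U) : V.ReflectionAlgebra ψ t c :=
  V.quotMap ψ t c (TwistedSmash.incl _ _ (TensorAlgebra.ι ℂ x))

/-- The image of a group element `g ∈ ℂ_ψ G` in `H_{t,c}(G,U,ψ)`. -/
def grp [Finite G] (V : SymplecticRep G U) (ψ : TwoCocycle G) (t : ℂ)
    (c : V.regularReflections ψ → ℂ) (g : G) : V.ReflectionAlgebra ψ t c :=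
  V.quotMap ψ t c (TwistedSmash.of _ _ g)

/-- The relations `y ⊗ x - x ⊗ y = t ω(x,y)` in the tensor algebra. -/
inductive WeylRel (V : SymplecticRep G U) (t : ℂ) :
    TensorAlgebra ℂ U → TensorAlgebra ℂ U → Prop
  | intro (x y : U) : WeylRel V t
      (TensorAlgebra.ι ℂ y * TensorAlgebra.ι ℂ x - TensorAlgebra.ι ℂ x * TensorAlgebra.ι ℂ y)
      (algebraMap ℂ _ (t * V.ω x y))

/-- The Weyl algebra `A_t(U) = TU / (y ⊗ x - x ⊗ y - t ω(x,y))`. -/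
abbrev WeylAlgebra (V : SymplecticRep G U) (t : ℂ) : Type v := RingQuot (V.WeylRel t)

/-- The canonical map `U → A_t(U)`. -/
def weylι (V : SymplecticRep G U) (t : ℂ) : U →ₗ[ℂ] V.WeylAlgebra t :=
  (RingQuot.mkAlgHom ℂ (V.WeylRel t)).toLinearMap ∘ₗ TensorAlgebra.ι ℂ

theorem weylι_comm (V : SymplecticRep G U) (t : ℂ) (x y : U) :
    V.weylι t y * V.weylι t x - V.weylι t x * V.weylι t y = algebraMap ℂ _ (t * V.ω x y) := by
  have h := RingQuot.mkAlgHom_rel ℂ (WeylRel.intro (V := V) (t := t) x y)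
  rwa [map_sub, map_mul, map_mul, AlgHom.commutes] at h

/-- The action of `G` on the Weyl algebra induced by the action on `U`. -/
def weylAction (V : SymplecticRep G U) (t : ℂ) :
    G →* (V.WeylAlgebra t →ₐ[ℂ] V.WeylAlgebra t) where
  toFun g := RingQuot.liftAlgHom ℂ ⟨TensorAlgebra.lift ℂ (V.weylι t ∘ₗ V.ρ g), by
    rintro _ _ ⟨x, y⟩
    simp only [map_sub, map_mul, TensorAlgebra.lift_ι_apply, LinearMap.comp_apply,
      AlgHom.commutes]
    rw [V.weylι_comm, V.invariant, map_mul]⟩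
  map_one' := by
    apply RingQuot.ringQuot_ext'
    ext x
    simp [weylι]
  map_mul' g h := by
    apply RingQuot.ringQuot_ext'
    ext x
    simp [weylι]

/-- `A_t(U) ⋊ ℂ_ψ G`. -/
abbrev WeylSmash (V : SymplecticRep G U) (t : ℂ) (ψ : TwoCocycle G) : Type (max u v) :=
  TwistedSmash (V.weylAction t) ψ

end SymplecticRep

/-- The symplectic representation `U = 𝔥 ⊕ 𝔥*` attached to a representation `𝔥`, with
`ω((y,x),(y',x')) = x(y') - x'(y)`. -/
def doubled {G : Type u} [Group G] {V : Type v} [AddCommGroup V] [Module ℂ V]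
    [Module.Finite ℂ V] (ρ : Representation ℂ G V) :
    SymplecticRep G (V × Module.Dual ℂ V) where
  ρ := ρ.prod ρ.dual
  ω := LinearMap.mk₂ ℂ (fun p q => p.2 q.1 - q.2 p.1)
    (fun p p' q => by simp; ring) (fun k p q => by simp; ring)
    (fun p q q' => by simp; ring) (fun k p q => by simp; ring)
  finite := inferInstance
  alt p := by simp
  nondegenerate := by
    have h : ∀ p : V × Module.Dual ℂ V, (∀ q : V × Module.Dual ℂ V, p.2 q.1 - q.2 p.1 = 0) →
        p = 0 := by
      rintro ⟨v, f⟩ hp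
      have hf : f = 0 := by
        ext w
        simpa using hp (w, 0)
      have hv : v = 0 := by
        rw [← Module.forall_dual_apply_eq_zero_iff ℂ]
        intro φ
        simpa using hp (0, φ)
      rw [hf, hv]; rfl
    constructor
    · intro p hp
      exact h p fun q => by simpa using hp q
    · intro p hp
      refine h p fun q => ?_
      have := hp q
      simp only [LinearMap.mk₂_apply] at this
      rw [← neg_eq_zero, ← this]
      ring
  invariant g p q := by simp [Representation.dual_apply, Module.Dual.transpose_apply]

/-! ### Coxeter groups -/

section Coxeter

variable {B : Type v}

/-- The Coxeter graph: `i` and `j` are joined iff `i ≠ j` and `m(i,j) ≠ 2`. -/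
def coxeterGraph (M : CoxeterMatrix B) : SimpleGraph B where
  Adj i j := i ≠ j ∧ M i j ≠ 2
  symm := ⟨fun i j h => ⟨h.1.symm, by rw [M.symmetric]; exact h.2⟩⟩
  loopless := ⟨fun _ h => h.1 rfl⟩

/-- A Coxeter matrix is irreducible if its Coxeter graph is connected (and nonempty). -/
def IsIrreducible (M : CoxeterMatrix B) : Prop := (coxeterGraph M).Connected

/-- The Coxeter matrix is, up to relabelling, that of type `BC_n` for some `n ≥ 2`. -/
def IsTypeBC (M : CoxeterMatrix B) : Prop :=
  ∃ n : ℕ, 2 ≤ n ∧ ∃ e : B ≃ Fin n, M.reindex e = CoxeterMatrix.B n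

/-- The coroot functional `v ↦ 2 B(α_i, v)`, where `B(α_i, α_j) = -cos (π / m(i,j))`
(and `π / ∞ = 0`, since `m(i,j) = 0` encodes `∞`). -/
def coroot (M : CoxeterMatrix B) (i : B) : Module.Dual ℂ (B →₀ ℂ) :=
  Finsupp.lsum ℂ fun j => (LinearMap.id : ℂ →ₗ[ℂ] ℂ).smulRight
    (2 * -((Real.cos (Real.pi / M i j) : ℝ) : ℂ))

theorem coroot_single (M : CoxeterMatrix B) (i j : B) :
    coroot M i (Finsupp.single j 1) = 2 * -((Real.cos (Real.pi / M i j) : ℝ) : ℂ) := by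
  simp [coroot]

theorem coroot_self (M : CoxeterMatrix B) (i : B) : coroot M i (Finsupp.single i 1) = 2 := by
  simp [coroot_single]

/-- The simple reflection `v ↦ v - 2 B(α_i, v) α_i` on the complex span of the simple roots
`α_j`, `j ∈ B`. -/
def simpleReflection (M : CoxeterMatrix B) (i : B) : (B →₀ ℂ) ≃ₗ[ℂ] (B →₀ ℂ) :=
  Module.reflection (coroot_self M i)

theorem simpleReflection_pow (M : CoxeterMatrix B) (i j : B) :
    (simpleReflection M i * simpleReflection M j) ^ M i j = 1 := by
  by_cases hij : i = j
  · subst hij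
    rw [M.diagonal, pow_one]
    exact LinearEquiv.ext fun v => Module.involutive_reflection (coroot_self M i) v
  rcases Nat.eq_zero_or_pos (M i j) with h0 | hpos
  · rw [h0, pow_zero]
  have hne1 : M i j ≠ 1 := M.off_diagonal i j hij
  have hab : coroot M i (Finsupp.single j 1) = 2 * -((Real.cos (Real.pi / M i j) : ℝ) : ℂ) :=
    coroot_single M i j
  have hba : coroot M j (Finsupp.single i 1) = 2 * -((Real.cos (Real.pi / M i j) : ℝ) : ℂ) := by
    rw [coroot_single, M.symmetric]
  apply LinearEquiv.toLinearMap_injective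
  rw [simpleReflection, simpleReflection, Module.reflection_mul_reflection_pow]
  rw [hab, hba]
  generalize coroot M i = f at *
  generalize coroot M j = f' at *
  generalize M i j = m at *
  by_cases h2 : m = 2
  · subst h2
    refine LinearMap.ext fun v => ?_
    norm_num
    abel
  have hm : 3 ≤ m := by omega
  have hmC : (m : ℂ) ≠ 0 := by exact_mod_cast hpos.ne'
  set φ : ℂ := 2 * (Real.pi / m) with hφ
  have ht : 2 * -((Real.cos (Real.pi / m) : ℝ) : ℂ) * (2 * -((Real.cos (Real.pi / m) : ℝ) : ℂ)) - 2
      = 2 * Complex.cos φ := by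
    rw [hφ, Complex.cos_two_mul]
    push_cast
    ring
  have hsin : Complex.sin φ ≠ 0 := by
    have : φ = ((2 * (Real.pi / m) : ℝ) : ℂ) := by rw [hφ]; push_cast; ring
    rw [this, ← Complex.ofReal_sin, Complex.ofReal_ne_zero]
    have hm' : (3 : ℝ) ≤ m := by exact_mod_cast hm
    apply (Real.sin_pos_of_pos_of_lt_pi _ _).ne'
    · have := Real.pi_pos
      positivity
    · rw [← mul_div_assoc, div_lt_iff₀ (by linarith)]
      nlinarith [Real.pi_pos]
  rw [ht]
  have hS := fun n => Polynomial.Chebyshev.S_two_mul_complex_cos φ n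
  obtain ⟨k, hk | hk⟩ := Nat.even_or_odd' m
  · have e1 : ((m : ℤ) - 2) / 2 = k - 1 := by omega
    have e2 : ((m : ℤ) - 1) / 2 = k - 1 := by omega
    have hz : (Polynomial.Chebyshev.S ℂ ((k : ℤ) - 1)).eval (2 * Complex.cos φ) = 0 := by
      have h := hS ((k : ℤ) - 1)
      have h' : ((((k : ℤ) - 1 : ℤ) : ℂ) + 1) * φ = Real.pi := by
        rw [hφ]
        have : (m : ℂ) = 2 * k := by exact_mod_cast hk
        have hk0 : (k : ℂ) ≠ 0 := fun h0 => hmC (by rw [this, h0, mul_zero])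
        rw [this]
        push_cast
        field_simp
        ring
      rw [h', Complex.sin_pi] at h
      exact (mul_eq_zero.mp h).resolve_right hsin
    rw [e1, e2, hz]
    simp only [zero_mul, zero_smul, add_zero]
    rfl
  · have e1 : ((m : ℤ) - 1) / 2 = k := by omega
    have e2 : ((m : ℤ) - 3) / 2 = k - 1 := by omega
    have e3 : (m : ℤ) / 2 = k := by omega
    have e4 : ((m : ℤ) - 2) / 2 = k - 1 := by omega
    have hz : (Polynomial.Chebyshev.S ℂ (k : ℤ)).eval (2 * Complex.cos φ)
        + (Polynomial.Chebyshev.S ℂ ((k : ℤ) - 1)).eval (2 * Complex.cos φ) = 0 := by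
      have h := hS (k : ℤ)
      have h' := hS ((k : ℤ) - 1)
      have hs : (((k : ℤ) : ℂ) + 1) * φ = 2 * Real.pi - ((((k : ℤ) - 1 : ℤ) : ℂ) + 1) * φ := by
        rw [hφ]
        have : (m : ℂ) = 2 * k + 1 := by exact_mod_cast hk
        have e : (Real.pi : ℂ) = m * (Real.pi / m) := by field_simp
        generalize (Real.pi : ℂ) / m = θ at *
        rw [e, this]
        push_cast
        ring
      rw [hs, Complex.sin_two_pi_sub] at h
      have := congrArg₂ (· + ·) h h'
      simp only [neg_add_cancel, ← add_mul] at this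
      exact (mul_eq_zero.mp this).resolve_right hsin
    rw [e1, e2, e3, e4, hz]
    simp only [mul_zero, zero_smul, add_zero]
    rfl

theorem simpleReflection_isLiftable (M : CoxeterMatrix B) :
    M.IsLiftable (G := Module.End ℂ (B →₀ ℂ)) fun i => (simpleReflection M i).toLinearMap := by
  intro i j
  have h := congrArg (LinearEquiv.automorphismGroup.toLinearMapMonoidHom (R := ℂ) (M := B →₀ ℂ))
    (simpleReflection_pow M i j)
  rw [map_pow, map_mul, map_one] at h
  exact h

/-- The (complexified) reflection representation of a Coxeter group. -/
def reflectionRep {G : Type u} [Group G] {M : CoxeterMatrix B} (cs : CoxeterSystem M G) :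
    Representation ℂ G (B →₀ ℂ) :=
  cs.lift ⟨_, simpleReflection_isLiftable M⟩

theorem reflectionRep_simple {G : Type u} [Group G] {M : CoxeterMatrix B} (cs : CoxeterSystem M G)
    (i : B) (v : B →₀ ℂ) :
    reflectionRep cs (cs.simple i) v = v - coroot M i v • Finsupp.single i 1 := by
  rw [reflectionRep, cs.lift_apply_simple (simpleReflection_isLiftable M)]
  exact Module.reflection_apply _ _

end Coxeter

/-- The symplectic representation `U = 𝔥 ⊕ 𝔥*` of a finite Coxeter group, `𝔥` being its reflection
representation; the twisted rational Cherednik algebras are the algebras `H_{t,c}(G,U,ψ)` for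
this `U`. -/
def cherednikRep {B : Type v} [Finite B] {G : Type u} [Group G] {M : CoxeterMatrix B}
    (cs : CoxeterSystem M G) : SymplecticRep G ((B →₀ ℂ) × Module.Dual ℂ (B →₀ ℂ)) :=
  doubled (reflectionRep cs)

end TwistedCherednik

end

noncomputable section

namespace TwistedCherednik

universe u v w

/-! ### Splitting central extensions of Coxeter groups -/

section Involutions

variable {E : Type*} [Group E]

/-! The cocycle defines a central extension of `G` by `ℂˣ`, and it is cohomologically trivial once
this extension splits, that is, once the simple reflections have lifts satisfying the Coxeter
relations. Regularity of a reflection `s` says that lifts of `s` commute with lifts of its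
centralizer. Hence an involutive lift of `s`, transported by conjugation, gives a well-defined lift
of every reflection conjugate to `s`, equivariant under conjugation.

Let `C` be the set of simple reflections conjugate to `s`. A relation involving some `i ∈ C` then
holds automatically. If the label is even, half of the rotation commutes with the lift of `s_i`,
which also inverts it, so its square is `1`. If the label is odd, a power of the rotation conjugates
one lift to the other, which is the relation (`exists_section`). Outside `C` the proof needs at most
two vertices, joined by an odd label, where one sign is adjusted. Edges leaving `C` have even label,
and positive definiteness of the Gram matrix (`gramQ_pos`) supplies this shape: null vectors of
affine diagrams exclude everything else except type `BC` with at least four vertices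
(`GramPosDef.isTypeBC`, `GramPosDef.exists_pair`). The classification of finite Coxeter groups is
not needed.

For the second statement, an element of rank `2` on `𝔥 ⊕ 𝔥*` has rank `1` on `𝔥`, and such an
element is a reflection of `G` (`isReflection_of_finrank`). This rests on positivity of roots, which
makes stabilizers of points off the root hyperplanes trivial. So if `ψ` is nontrivial there are no
regular symplectic reflections, the sum in the defining relation is empty, and universal properties
identify the two algebras (`SymplecticRep.exists_equiv_smash`). -/

theorem conj_mul_pow_of_involutions {a b : E} (ha : a * a = 1) (hb : b * b = 1) (n : ℕ) :
    a * (a * b) ^ n * a⁻¹ = ((a * b) ^ n)⁻¹ := by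
  have ha' : a⁻¹ = a := inv_eq_of_mul_eq_one_left ha
  have hb' : b⁻¹ = b := inv_eq_of_mul_eq_one_left hb
  rw [← conj_pow, ← inv_pow, mul_inv_rev, ha', hb', ← mul_assoc, ha, one_mul]

/-- The involution `a` inverts every power of `a * b`; a power that it also centralizes equals its
own inverse. -/
theorem mul_pow_sq_of_involutions {a b : E} (ha : a * a = 1) (hb : b * b = 1) {n : ℕ}
    (hn : Commute a ((a * b) ^ n)) : (a * b) ^ n * (a * b) ^ n = 1 := by
  have h := conj_mul_pow_of_involutions ha hb n
  rw [hn.eq, mul_inv_cancel_right] at h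
  nth_rw 1 [h]
  exact inv_mul_cancel _

theorem conj_pow_of_involutions {a b : E} (ha : a * a = 1) (hb : b * b = 1) (n : ℕ) :
    (a * b) ^ n * a * ((a * b) ^ n)⁻¹ = (a * b) ^ (2 * n + 1) * b := by
  rw [← conj_mul_pow_of_involutions ha hb n]
  have ha' : a⁻¹ = a := inv_eq_of_mul_eq_one_left ha
  calc (a * b) ^ n * a * (a * (a * b) ^ n * a⁻¹)
      = (a * b) ^ n * (a * a) * (a * b) ^ n * a⁻¹ := by group
    _ = (a * b) ^ (2 * n) * a := by rw [ha, mul_one, ← pow_add, two_mul, ha']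
    _ = (a * b) ^ (2 * n) * (a * (b * b)) := by rw [hb, mul_one]
    _ = _ := by rw [pow_succ]; group

end Involutions

section Splitting

variable {E : Type u} {G : Type v} [Group E] [Group G]

/-- All lifts of `s` commute with all lifts of elements of the centralizer of `s`. -/
def LiftsCommute (p : E →* G) (s : G) : Prop :=
  ∀ x y : E, p x = s → Commute (p x) (p y) → Commute x y

/-- Conjugating by a lift of the conjugating element carries one condition to the other. -/
theorem LiftsCommute.conj {p : E →* G} (hp : Function.Surjective p) {s : G}
    (hs : LiftsCommute p s) {s' : G} (h : IsConj s s') : LiftsCommute p s' := by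
  obtain ⟨g, rfl⟩ := isConj_iff.mp h
  obtain ⟨u, rfl⟩ := hp g
  intro x y hx hxy
  have key := hs (u⁻¹ * x * u) (u⁻¹ * y * u) (by simp [hx, mul_assoc]) (by
    have := (Commute.conj_iff (p u)⁻¹).mpr hxy
    simpa using this)
  have := (Commute.conj_iff u).mpr key
  simpa [mul_assoc] using this

variable {B : Type w} {M : CoxeterMatrix B}

/-- A central extension of a Coxeter group by a 2-divisible group splits if the lifts of some
simple reflection commute with the lifts of its centralizer, and the simple reflections that are
not conjugate to it are at most two, of odd order product. -/
theorem exists_section (cs : CoxeterSystem M G) (p : E →* G) (hp : Function.Surjective p)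
    (hcent : ∀ z, p z = 1 → ∀ x, Commute z x)
    (hsq : ∀ z, p z = 1 → ∃ w, p w = 1 ∧ w * w = z) (r : B)
    (hr : LiftsCommute p (cs.simple r)) (b d : B)
    (hD : ∀ i, IsConj (cs.simple r) (cs.simple i) ∨ i = b ∨ i = d)
    (hbd : b = d ∨ Odd (M b d)) : ∃ σ : G →* E, ∀ g, p (σ g) = g := by
  -- The square of any lift is in the central kernel; dividing the lift by a square root of it makes
  -- the lift an involution.
  have hlift : ∀ i, ∃ x, p x = cs.simple i ∧ x * x = 1 := by
    intro i
    obtain ⟨x, hx⟩ := hp (cs.simple i)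
    obtain ⟨w, hw, hwx⟩ := hsq (x * x) (by simp [hx])
    refine ⟨x * w⁻¹, by simp [hw, hx], ?_⟩
    have hc := (hcent w hw x).inv_left
    rw [mul_assoc, ← mul_assoc w⁻¹, hc.eq, mul_assoc, ← mul_assoc, ← hwx]
    group
  choose y hy hyy using hlift
  have hpow : ∀ (x : B → E) (_ : ∀ i, p (x i) = cs.simple i) (i j : B) (z : E),
      Commute ((x i * x j) ^ M i j) z := fun x hx i j z => hcent _ (by simp [hx]) z
  have hC : ∀ i, IsConj (cs.simple r) (cs.simple i) →
      ∃ g, cs.simple i = p g * cs.simple r * (p g)⁻¹ := by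
    intro i hi
    obtain ⟨g, hg⟩ := isConj_iff.mp hi
    obtain ⟨u, rfl⟩ := hp g
    exact ⟨u, hg.symm⟩
  classical
  choose! g hg using hC
  -- The defect of the relation between `b` and `d`. It is central, and it is inverted by `y b`, so
  -- `c * c = 1`.
  let c : E := (y b * y d) ^ M b d
  have hcc : c * c = 1 := mul_pow_sq_of_involutions (hyy b) (hyy d) (hpow y hy b d _).symm
  have hc : ∀ z, Commute c z := hpow y hy b d
  have hpc : p c = 1 := by simp [c, hy]
  -- On the class of `r` the lifts are conjugates of the single lift `y r`; the factor `c` at `d`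
  -- repairs the one relation left outside the class.
  let x : B → E := fun i => if IsConj (cs.simple r) (cs.simple i) then g i * y r * (g i)⁻¹
    else if i = b then y b else y d * c
  have hxC : ∀ i, IsConj (cs.simple r) (cs.simple i) → x i = g i * y r * (g i)⁻¹ :=
    fun i hi => if_pos hi
  have hxb : ¬ IsConj (cs.simple r) (cs.simple b) → x b = y b := fun hb =>
    (if_neg hb).trans (if_pos rfl)
  have hxd : ¬ IsConj (cs.simple r) (cs.simple d) → d ≠ b → x d = y d * c := fun hb h =>
    (if_neg hb).trans (if_neg h)
  have hx : ∀ i, p (x i) = cs.simple i := by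
    intro i
    by_cases hi : IsConj (cs.simple r) (cs.simple i)
    · rw [hxC i hi, map_mul, map_mul, hy, map_inv, ← hg i hi]
    · by_cases hib : i = b
      · subst hib; rw [hxb hi, hy]
      · obtain rfl := ((hD i).resolve_left hi).resolve_left hib
        rw [hxd hi hib, map_mul, hpc, mul_one, hy]
  have hxx : ∀ i, x i * x i = 1 := by
    intro i
    by_cases hi : IsConj (cs.simple r) (cs.simple i)
    · rw [hxC i hi]
      calc _ = g i * (y r * y r) * (g i)⁻¹ := by group
        _ = 1 := by rw [hyy]; group
    · by_cases hib : i = b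
      · subst hib; rw [hxb hi, hyy]
      · obtain rfl := ((hD i).resolve_left hi).resolve_left hib
        rw [hxd hi hib, mul_assoc, ← mul_assoc c, (hc (y i)).eq, mul_assoc, hcc, mul_one, hyy]
  -- Independence of the conjugator: two conjugators differ by a lift of an element centralizing
  -- `r`, which commutes with `y r` by `hr`.
  have hconj : ∀ i j u, IsConj (cs.simple r) (cs.simple i) → IsConj (cs.simple r) (cs.simple j) →
      p u * cs.simple i * (p u)⁻¹ = cs.simple j → u * x i * u⁻¹ = x j := by
    intro i j u hi hj h
    have hcomm : Commute (y r) ((g j)⁻¹ * u * g i) := by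
      refine hr _ _ (hy r) ?_
      rw [hg i hi, hg j hj] at h
      rw [hy, Commute, SemiconjBy, map_mul, map_mul, map_inv]
      have h' := congrArg (fun z => (p (g j))⁻¹ * z * (p u * p (g i))) h
      simp only [mul_assoc, inv_mul_cancel_left, inv_mul_cancel, mul_one] at h' ⊢
      exact h'.symm
    rw [hxC i hi, hxC j hj]
    calc _ = g j * (((g j)⁻¹ * u * g i) * y r) * (g i)⁻¹ * u⁻¹ := by group
      _ = g j * (y r * ((g j)⁻¹ * u * g i)) * (g i)⁻¹ * u⁻¹ := by rw [hcomm.eq]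
      _ = _ := by group
  have hss : ∀ i, cs.simple i * cs.simple i = 1 := cs.simple_mul_simple_self
  -- With label `2k`, the element `(s_i s_j) ^ k` is its own inverse and is inverted by `s_i`, hence
  -- commutes with `s_i`; regularity lifts this commutation to `E`.
  have heven : ∀ i j, IsConj (cs.simple r) (cs.simple i) → Even (M i j) →
      (x i * x j) ^ M i j = 1 := by
    rintro i j hi ⟨k, hk⟩
    have hcomm : Commute (x i) ((x i * x j) ^ k) := by
      refine hr.conj hp hi _ _ (hx i) ?_
      have hs : (cs.simple i * cs.simple j) ^ k * (cs.simple i * cs.simple j) ^ k = 1 := by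
        rw [← pow_add, ← hk, cs.simple_mul_simple_pow]
      have := conj_mul_pow_of_involutions (hss i) (hss j) k
      rw [inv_eq_of_mul_eq_one_left hs] at this
      rw [map_pow, map_mul, hx, hx]
      exact mul_inv_eq_iff_eq_mul.mp this
    rw [hk, pow_add]
    exact mul_pow_sq_of_involutions (hxx i) (hxx j) hcomm
  have hsymm : ∀ i j, (x i * x j) ^ M i j = 1 → (x j * x i) ^ M j i = 1 := by
    intro i j h
    rw [M.symmetric, ← inv_eq_one, ← inv_pow, mul_inv_rev, inv_eq_of_mul_eq_one_left (hxx i),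
      inv_eq_of_mul_eq_one_left (hxx j), h]
  have hodd : ∀ i j k, M i j = 2 * k + 1 →
      (cs.simple i * cs.simple j) ^ k * cs.simple i * ((cs.simple i * cs.simple j) ^ k)⁻¹
        = cs.simple j := by
    intro i j k hk
    rw [conj_pow_of_involutions (hss i) (hss j), ← hk, cs.simple_mul_simple_pow, one_mul]
  have hCodd : ∀ i j, IsConj (cs.simple r) (cs.simple i) → Odd (M i j) →
      IsConj (cs.simple r) (cs.simple j) := by
    rintro i j hi ⟨k, hk⟩
    exact hi.trans (isConj_iff.mpr ⟨_, hodd i j k hk⟩)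
  have hfull : ∀ i j, IsConj (cs.simple r) (cs.simple i) → (x i * x j) ^ M i j = 1 := by
    intro i j hi
    rcases Nat.even_or_odd (M i j) with h | h
    · exact heven i j hi h
    · have hj := hCodd i j hi h
      obtain ⟨k, hk⟩ := h
      -- With label `2k + 1`, this power conjugates `x i` to `x j`; the same conjugate is also `(x i
      -- * x j) ^ (2k + 1) * x j`, so the power is `1`.
      have := hconj i j ((x i * x j) ^ k) hi hj (by
        rw [map_pow, map_mul, hx, hx]; exact hodd i j k hk)
      rw [conj_pow_of_involutions (hxx i) (hxx j), ← hk] at this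
      simpa using this
  have hbdx : ¬ IsConj (cs.simple r) (cs.simple b) → ¬ IsConj (cs.simple r) (cs.simple d) →
      d ≠ b → (x b * x d) ^ M b d = 1 := by
    intro hb hd h
    obtain ⟨k, hk⟩ := hbd.resolve_left h.symm
    -- Inserting the central `c` multiplies the defect `c` by `c ^ M b d`; the exponent becomes `M b
    -- d + 1`, even because the label is odd.
    rw [hxb hb, hxd hd h, ← mul_assoc, (hc _).symm.mul_pow]
    change c * c ^ M b d = 1
    rw [← pow_succ', hk, show 2 * k + 1 + 1 = 2 * (k + 1) by ring, pow_mul, pow_two, hcc, one_pow]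
  have hlift : M.IsLiftable x := by
    intro i j
    by_cases hi : IsConj (cs.simple r) (cs.simple i)
    · exact hfull i j hi
    by_cases hj : IsConj (cs.simple r) (cs.simple j)
    · exact hsymm j i (hfull j i hj)
    by_cases hij : i = j
    · rw [hij, hxx, one_pow]
    rcases (hD i).resolve_left hi with rfl | rfl
    · obtain rfl := ((hD j).resolve_left hj).resolve_left (Ne.symm hij)
      exact hbdx hi hj (Ne.symm hij)
    · by_cases hib : i = b
      · subst hib
        obtain rfl := ((hD j).resolve_left hj).elim id id
        exact absurd rfl hij
      · obtain rfl := ((hD j).resolve_left hj).resolve_right (Ne.symm hij)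
        exact hsymm _ _ (hbdx hj hi hib)
  refine ⟨cs.lift ⟨x, hlift⟩, fun a => ?_⟩
  have : p.comp (cs.lift ⟨x, hlift⟩) = MonoidHom.id G := cs.ext_simple fun i => by simp [hx]
  exact DFunLike.congr_fun this a

end Splitting

/-! ### The central extension defined by a two-cocycle -/

namespace TwoCocycle

variable {G : Type u} [Group G] (ψ : TwoCocycle G)

/-- The central extension of `G` by `ℂˣ` defined by a two-cocycle. -/
@[ext] structure Extension (ψ : TwoCocycle G) where
  /-- The scalar component. -/
  coeff : ℂˣ
  /-- The component in `G`. -/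
  elt : G

namespace Extension

instance : Mul ψ.Extension := ⟨fun x y => ⟨x.coeff * y.coeff * ψ x.elt y.elt, x.elt * y.elt⟩⟩
-- The cocycle is not normalized, so the unit carries the factor `ψ(1,1)⁻¹`.
instance : One ψ.Extension := ⟨⟨(ψ 1 1)⁻¹, 1⟩⟩
instance : Inv ψ.Extension :=
  ⟨fun x => ⟨(x.coeff * ψ x.elt⁻¹ x.elt * ψ 1 1)⁻¹, x.elt⁻¹⟩⟩

variable {ψ}

@[simp] theorem mul_coeff (x y : ψ.Extension) :
    (x * y).coeff = x.coeff * y.coeff * ψ x.elt y.elt := rfl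
@[simp] theorem mul_elt (x y : ψ.Extension) : (x * y).elt = x.elt * y.elt := rfl
@[simp] theorem one_coeff : (1 : ψ.Extension).coeff = (ψ 1 1)⁻¹ := rfl
@[simp] theorem one_elt : (1 : ψ.Extension).elt = 1 := rfl
@[simp] theorem inv_coeff (x : ψ.Extension) :
    x⁻¹.coeff = (x.coeff * ψ x.elt⁻¹ x.elt * ψ 1 1)⁻¹ := rfl
@[simp] theorem inv_elt (x : ψ.Extension) : x⁻¹.elt = x.elt⁻¹ := rfl

instance : Group ψ.Extension :=
  Group.ofLeftAxioms
    (fun x y z => by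
      ext1
      · have h := ψ.cocycle x.elt y.elt z.elt
        simp only [mul_coeff, mul_elt]
        calc _ = x.coeff * y.coeff * z.coeff *
              (ψ x.elt y.elt * ψ (x.elt * y.elt) z.elt) := by ac_rfl
          _ = _ := by rw [h]; ac_rfl
      · exact mul_assoc _ _ _)
    (fun x => by
      ext1
      · simp [ψ.map_one_left, mul_comm]
      · simp)
    (fun x => by
      ext1
      · simp only [mul_coeff, inv_coeff, inv_elt, one_coeff]
        rw [mul_inv, mul_assoc, mul_right_comm, inv_mul_cancel, one_mul]
      · simp)

/-- The projection onto `G`. -/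
def proj (ψ : TwoCocycle G) : ψ.Extension →* G where
  toFun := elt
  map_one' := rfl
  map_mul' _ _ := rfl

theorem proj_surjective : Function.Surjective (proj ψ) := fun g => ⟨⟨1, g⟩, rfl⟩

theorem commute_of_proj_eq_one (z : ψ.Extension) (hz : proj ψ z = 1) (x : ψ.Extension) :
    Commute z x := by
  obtain ⟨a, g⟩ := z
  obtain rfl : g = 1 := hz
  ext1
  · simp [ψ.map_one_left, ψ.map_one_right, mul_comm]
  · simp

theorem exists_sqrt (z : ψ.Extension) (hz : proj ψ z = 1) :
    ∃ w, proj ψ w = 1 ∧ w * w = z := by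
  obtain ⟨a, g⟩ := z
  obtain rfl : g = 1 := hz
  -- The square of `(c, 1)` is `(c ^ 2 * ψ(1,1), 1)`, whence the correction by `ψ(1,1)⁻¹`.
  obtain ⟨c, hc⟩ := IsAlgClosed.exists_pow_nat_eq (((a * (ψ 1 1)⁻¹ : ℂˣ)) : ℂ) two_pos
  have hc0 : c ≠ 0 := by
    rintro rfl
    exact Units.ne_zero _ (by rw [← hc]; simp)
  have hc' : Units.mk0 c hc0 * Units.mk0 c hc0 = a * (ψ 1 1)⁻¹ := by
    ext1
    rw [← hc, pow_two]
    rfl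
  refine ⟨⟨Units.mk0 c hc0, 1⟩, rfl, ?_⟩
  ext1
  · simp [hc']
  · simp

/-- The products in the two orders have scalar components differing only in `ψ(s,h)` versus
`ψ(h,s)`. -/
theorem liftsCommute_of_isRegular {s : G} (hs : ψ.IsRegular s) :
    LiftsCommute (proj ψ) s := by
  rintro x y rfl hxy
  have h := hs y.elt (Subgroup.mem_centralizer_singleton_iff.mpr hxy.eq.symm)
  ext1
  · simp only [mul_coeff]
    rw [mul_comm x.coeff]
    exact congrArg _ h
  · exact hxy

/-- For a section `g ↦ (φ g, g)`, multiplicativity reads `φ(gh) = φ(g) φ(h) ψ(g,h)`, so `ψ` is the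
coboundary of `φ⁻¹`. -/
theorem cohomologous_trivial_of_section (σ : G →* ψ.Extension) (hσ : ∀ g, proj ψ (σ g) = g) :
    ψ.Cohomologous (TwoCocycle.trivial G) := by
  refine ⟨fun g => (σ g).coeff⁻¹, fun g h => ?_⟩
  have h1 := congrArg coeff (map_mul σ g h)
  have hg : ∀ g, (σ g).elt = g := hσ
  rw [mul_coeff, hg, hg] at h1
  simp only [inv_inv, h1, TwoCocycle.trivial, one_mul]
  rw [← mul_inv, inv_mul_cancel_left]

end Extension

end TwoCocycle

/-! ### Positive definiteness of the form of a finite irreducible Coxeter group -/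

section PosDef

variable {B : Type v}

/-- The entries `-2 cos (π / m(i,j))` of (twice) the Gram matrix of the simple roots. -/
def gram (M : CoxeterMatrix B) (i j : B) : ℝ := 2 * -Real.cos (Real.pi / M i j)

theorem coroot_single_eq_gram (M : CoxeterMatrix B) (i j : B) :
    coroot M i (Finsupp.single j 1) = (gram M i j : ℂ) := by
  rw [coroot_single, gram]; push_cast; rfl

theorem gram_symm (M : CoxeterMatrix B) (i j : B) : gram M i j = gram M j i := by
  rw [gram, gram, M.symmetric]

theorem gram_self (M : CoxeterMatrix B) (i : B) : gram M i i = 2 := by simp [gram]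

/-- The quadratic form of the Gram matrix. -/
def gramQ [Fintype B] (M : CoxeterMatrix B) (x : B → ℝ) : ℝ :=
  ∑ i, ∑ j, x i * x j * gram M i j

theorem coroot_apply [Fintype B] (M : CoxeterMatrix B) (i : B) (v : B →₀ ℂ) :
    coroot M i v = ∑ j, v j * (gram M i j : ℂ) := by
  conv_lhs => rw [← Finsupp.univ_sum_single v]
  rw [map_sum]
  refine Finset.sum_congr rfl fun j _ => ?_
  rw [← mul_one (v j), ← smul_eq_mul, ← Finsupp.smul_single, map_smul, coroot_single_eq_gram]
  simp

variable {G : Type u} [Group G] {M : CoxeterMatrix B}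

section Averaging

variable (ρ : Representation ℂ G (B →₀ ℂ))

/-- The embedding of a representation into a Hermitian space by all coordinates of all
translates; the pulled back inner product is invariant. -/
def orbitCoords : (B →₀ ℂ) →ₗ[ℂ] EuclideanSpace ℂ (G × B) where
  toFun v := WithLp.toLp 2 fun p => ρ p.1 v p.2
  map_add' v w := by ext p; simp
  map_smul' c v := by ext p; simp

theorem orbitCoords_injective : Function.Injective (orbitCoords ρ) := by
  intro v w h
  ext b
  have := congrArg (fun z : EuclideanSpace ℂ (G × B) => z (1, b)) h
  simpa [orbitCoords] using this

/-- Unitary averaging: translating by `g` only permutes the summands indexed by `G`. -/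
theorem inner_orbitCoords [Fintype G] [Fintype B] (g : G) (v w : B →₀ ℂ) :
    inner ℂ (orbitCoords ρ (ρ g v)) (orbitCoords ρ (ρ g w))
      = inner ℂ (orbitCoords ρ v) (orbitCoords ρ w) := by
  simp only [PiLp.inner_apply, orbitCoords, LinearMap.coe_mk, AddHom.coe_mk, Fintype.sum_prod_type]
  rw [← Equiv.sum_comp (Equiv.mulRight g)
    (fun h => ∑ b, inner ℂ ((ρ h v) b) ((ρ h w) b))]
  simp [map_mul]

end Averaging

/-- The Gram matrix of a finite irreducible Coxeter group is positive definite. -/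
theorem gramQ_pos [Finite G] [Fintype B] (cs : CoxeterSystem M G) (hirr : IsIrreducible M)
    {x : B → ℝ} (hx : x ≠ 0) : 0 < gramQ M x := by
  have := Fintype.ofFinite G
  set T := orbitCoords (reflectionRep cs) with hT
  let a : B → EuclideanSpace ℂ (G × B) := fun i => T (Finsupp.single i 1)
  have ha0 : ∀ i, a i ≠ 0 := fun i h => by
    have := orbitCoords_injective (reflectionRep cs) (h.trans (map_zero T).symm)
    simp at this
  -- Invariance under `s_i`, which negates `a i`, gives `-⟨a_i, a_j - gram • a_i⟩ = ⟨a_i, a_j⟩`.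
  have h1 : ∀ i j, 2 * inner ℂ (a i) (a j) = (gram M i j : ℂ) * (‖a i‖ ^ 2 : ℝ) := by
    intro i j
    have h := inner_orbitCoords (reflectionRep cs) (cs.simple i) (Finsupp.single i 1)
      (Finsupp.single j 1)
    rw [reflectionRep_simple, reflectionRep_simple, coroot_self, coroot_single_eq_gram,
      ← hT, map_sub, map_sub, map_smul, map_smul] at h
    change inner ℂ (a i - (2 : ℂ) • a i) (a j - (gram M i j : ℂ) • a i) = inner ℂ (a i) (a j) at h
    have e : a i - (2 : ℂ) • a i = - a i := by rw [two_smul]; abel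
    rw [e, inner_neg_left, inner_sub_right, inner_smul_right, inner_self_eq_norm_sq_to_K] at h
    push_cast
    have h' : ((‖a i‖ : ℝ) : ℂ) ^ 2 = (RCLike.ofReal ‖a i‖ : ℂ) ^ 2 := rfl
    rw [h']
    linear_combination -h
  have h2 : ∀ i j, 2 * (inner ℂ (a i) (a j)).re = gram M i j * ‖a i‖ ^ 2 := by
    intro i j
    have := congrArg Complex.re (h1 i j)
    rw [← Complex.ofReal_mul, Complex.ofReal_re] at this
    rw [← this]
    simp
  have h3 : ∀ i j, gram M i j * ‖a i‖ ^ 2 = gram M i j * ‖a j‖ ^ 2 := by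
    intro i j
    rw [← h2, gram_symm, ← h2, ← inner_conj_symm (a i), Complex.conj_re]
  -- The entry is symmetric and nonzero on an edge, so the norms at its ends agree; by connectedness
  -- all norms agree. The Gram matrix is therefore a positive multiple of that of the independent
  -- vectors `a i`.
  have hadj : ∀ i j, (coxeterGraph M).Adj i j → ‖a i‖ ^ 2 = ‖a j‖ ^ 2 := by
    intro i j hij
    refine mul_left_cancel₀ ?_ (h3 i j)
    have hne1 : M i j ≠ 1 := M.off_diagonal i j hij.1
    have hne2 : M i j ≠ 2 := hij.2
    intro h0
    rw [gram] at h0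
    generalize M i j = m at *
    have hc : Real.cos (Real.pi / m) = 0 := by linarith
    rcases Nat.eq_zero_or_pos m with rfl | hm
    · simp at hc
    have hm3 : (3 : ℝ) ≤ m := by exact_mod_cast (by omega : 3 ≤ m)
    refine (Real.cos_pos_of_mem_Ioo ⟨?_, ?_⟩).ne' hc
    · have := Real.pi_pos
      have : 0 < Real.pi / m := by positivity
      linarith
    · rw [div_lt_div_iff₀ (by linarith) two_pos]
      nlinarith [Real.pi_pos]
  have hconst : ∀ i j, ‖a i‖ ^ 2 = ‖a j‖ ^ 2 := by
    intro i j
    obtain ⟨W⟩ := hirr.preconnected i j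
    induction W with
    | nil => rfl
    | cons h _ ih => exact (hadj _ _ h).trans ih
  obtain ⟨i₀⟩ := hirr.nonempty
  have hd : 0 < ‖a i₀‖ ^ 2 := by
    have := norm_pos_iff.mpr (ha0 i₀)
    positivity
  let v : B →₀ ℂ := Finsupp.equivFunOnFinite.symm fun i => (x i : ℂ)
  have hv : v ≠ 0 := by
    intro h
    apply hx
    ext i
    have := DFunLike.congr_fun h i
    simpa [v] using this
  have hTv : T v = ∑ i, (x i : ℂ) • a i := by
    have : v = ∑ i, (x i : ℂ) • Finsupp.single i (1 : ℂ) := by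
      rw [← Finsupp.univ_sum_single v]
      simp [v]
    rw [this, map_sum]
    simp only [map_smul, a]
  have hpos : 0 < (inner ℂ (T v) (T v)).re := by
    have h0 : T v ≠ 0 := fun h =>
      hv (orbitCoords_injective (reflectionRep cs) (h.trans (map_zero T).symm))
    exact (re_inner_self_pos (𝕜 := ℂ)).mpr h0
  have hexp : (inner ℂ (T v) (T v)).re = ‖a i₀‖ ^ 2 / 2 * gramQ M x := by
    rw [hTv, sum_inner, Complex.re_sum, gramQ, Finset.mul_sum]
    refine Finset.sum_congr rfl fun i _ => ?_
    rw [inner_sum, Complex.re_sum, Finset.mul_sum]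
    refine Finset.sum_congr rfl fun j _ => ?_
    rw [inner_smul_left, inner_smul_right, Complex.conj_ofReal, Complex.re_ofReal_mul,
      Complex.re_ofReal_mul]
    have := h2 i j
    rw [hconst i i₀] at this
    linear_combination (x i * x j / 2) * this
  rw [hexp] at hpos
  exact pos_of_mul_pos_right hpos (by positivity)

/-- The simple coroots form a basis of the dual. -/
theorem exists_coroot_eq [Finite G] [Finite B] (cs : CoxeterSystem M G) (hirr : IsIrreducible M)
    (f : B → ℂ) : ∃ v, ∀ i, coroot M i v = f i := by
  have := Fintype.ofFinite B
  have hinj : Function.Injective (LinearMap.pi (coroot M)) := by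
    rw [← LinearMap.ker_eq_bot, LinearMap.ker_eq_bot']
    intro v hv
    have hv' : ∀ i, ∑ j, v j * (gram M i j : ℂ) = 0 := fun i => by
      rw [← coroot_apply]; exact congrFun hv i
    -- The matrix is real, so real and imaginary parts of a kernel vector are in the kernel, where
    -- the positive definite form vanishes.
    have key : ∀ y : B → ℝ, (∀ i, ∑ j, y j * gram M i j = 0) → y = 0 := by
      intro y hy
      by_contra h
      refine (gramQ_pos cs hirr h).ne' ?_
      rw [gramQ]
      refine Finset.sum_eq_zero fun i _ => ?_
      simp_rw [mul_assoc]
      rw [← Finset.mul_sum, hy, mul_zero]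
    have hre := key (fun j => (v j).re) fun i => by
      simpa using congrArg Complex.re (hv' i)
    have him := key (fun j => (v j).im) fun i => by
      simpa using congrArg Complex.im (hv' i)
    ext j
    exact Complex.ext (congrFun hre j) (congrFun him j)
  have hsurj : Function.Surjective (LinearMap.pi (coroot M)) :=
    (LinearMap.injective_iff_surjective_of_finrank_eq_finrank (by simp)).mp hinj
  obtain ⟨v, hv⟩ := hsurj f
  exact ⟨v, fun i => congrFun hv i⟩

end PosDef

/-! ### Coxeter graphs with positive definite Gram matrix -/

section Diagram

variable {B : Type v} {M : CoxeterMatrix B}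

/-- The cosine of `π / m` grows with `m`. The label `0` encodes infinity, and division by zero gives
`cos 0 = 1`, the correct limit. -/
theorem gram_le_of_le {M : CoxeterMatrix B} {i j : B} {n : ℕ} (hn : 2 ≤ n)
    (h : M i j = 0 ∨ n ≤ M i j) : gram M i j ≤ -(2 * Real.cos (Real.pi / n)) := by
  rw [gram]
  generalize M i j = m at *
  have hn' : (2 : ℝ) ≤ n := by exact_mod_cast hn
  have hpi := Real.pi_pos
  rcases h with rfl | h
  · have := Real.cos_le_one (Real.pi / n)
    simp only [CharP.cast_eq_zero, div_zero, Real.cos_zero]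
    linarith
  · have hm : (n : ℝ) ≤ m := by exact_mod_cast h
    have := Real.cos_le_cos_of_nonneg_of_le_pi (x := Real.pi / m) (y := Real.pi / n)
      (by positivity) (div_le_self hpi.le (by linarith)) (by gcongr)
    linarith

theorem gram_nonpos {i j : B} (hij : i ≠ j) : gram M i j ≤ 0 := by
  have hne1 : M i j ≠ 1 := M.off_diagonal i j hij
  have := gram_le_of_le (M := M) (i := i) (j := j) le_rfl (by omega)
  simpa using this

theorem gram_le_of_adj {i j : B} (hij : (coxeterGraph M).Adj i j) : gram M i j ≤ -1 := by
  have hne1 : M i j ≠ 1 := M.off_diagonal i j hij.1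
  have hne2 : M i j ≠ 2 := hij.2
  have := gram_le_of_le (M := M) (i := i) (j := j) (n := 3) (by norm_num) (by omega)
  simpa using this

/-- The edge `i j` of the Coxeter graph has label at least `4`. -/
def IsHeavy (M : CoxeterMatrix B) (i j : B) : Prop := M i j = 0 ∨ 4 ≤ M i j

theorem IsHeavy.gram_le {i j : B} (hij : IsHeavy M i j) : gram M i j ≤ -√2 := by
  have := gram_le_of_le (M := M) (n := 4) (by norm_num) hij
  rw [show ((4 : ℕ) : ℝ) = 4 by norm_num, Real.cos_pi_div_four] at this
  linarith

theorem IsHeavy.symm {i j : B} (hij : IsHeavy M i j) : IsHeavy M j i := by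
  rwa [IsHeavy, M.symmetric]

theorem IsHeavy.ne {i j : B} (hij : IsHeavy M i j) : i ≠ j := by
  rintro rfl
  rcases hij with h | h <;> simp at h

theorem IsHeavy.adj {i j : B} (hij : IsHeavy M i j) : (coxeterGraph M).Adj i j :=
  ⟨hij.ne, fun h => by rcases hij with h' | h' <;> omega⟩

theorem eq_three_of_adj {i j : B} (hij : (coxeterGraph M).Adj i j) (h : ¬ IsHeavy M i j) :
    M i j = 3 := by
  have hne1 : M i j ≠ 1 := M.off_diagonal i j hij.1
  have hne2 : M i j ≠ 2 := hij.2
  rw [IsHeavy] at h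
  omega

theorem update_nonneg [DecidableEq B] {x : B → ℝ} (hx : ∀ i, 0 ≤ x i) (q : B) {y : ℝ} (hy : 0 ≤ y) (i : B) :
    0 ≤ Function.update x q y i := by
  by_cases h : i = q
  · subst h; simpa
  · simpa [h] using hx i

section Update

variable [Fintype B] [DecidableEq B]

theorem gramQ_update {x : B → ℝ} {q : B} (hq : x q = 0) (y : ℝ) :
    gramQ M (Function.update x q y) = gramQ M x + 2 * y * ∑ j, x j * gram M j q + 2 * y ^ 2 := by
  have hu : ∀ i, Function.update x q y i = x i + if i = q then y else 0 := by
    intro i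
    by_cases h : i = q
    · subst h; simp [hq]
    · simp [h]
  simp only [gramQ, hu, add_mul, mul_add, Finset.sum_add_distrib, ite_mul, mul_ite, zero_mul,
    mul_zero, Finset.sum_ite_eq', Finset.mem_univ, if_true, Finset.sum_ite_irrel,
    Finset.sum_const_zero, gram_self]
  have : ∀ j, y * x j * gram M q j = y * (x j * gram M j q) := fun j => by
    rw [gram_symm]; ring
  have h' : ∀ j, x j * y * gram M j q = y * (x j * gram M j q) := fun j => by ring
  simp only [this, h', ← Finset.mul_sum]
  ring

/-- Off-diagonal entries are nonpositive, so edges left out of the count can only lower the form on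
a nonnegative vector. Hence forbidden diagrams need not be induced subgraphs. -/
theorem sum_mul_gram_le {x : B → ℝ} (hx : ∀ i, 0 ≤ x i) {q : B} (hq : x q = 0)
    (S : Finset B) : ∑ j, x j * gram M j q ≤ ∑ j ∈ S, x j * gram M j q := by
  rw [← Finset.sum_add_sum_compl S]
  have : ∑ j ∈ Sᶜ, x j * gram M j q ≤ 0 := Finset.sum_nonpos fun j _ => by
    by_cases h : j = q
    · rw [h, hq, zero_mul]
    · exact mul_nonpos_of_nonneg_of_nonpos (hx j) (gram_nonpos h)
  linarith

/-- A nonnegative vector `x` with `x q = 0`, extended by `y` at `q`, seen from one vertex `p`. -/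
theorem gramQ_update_le {x : B → ℝ} (hx : ∀ i, 0 ≤ x i) {q : B} (hq : x q = 0) {y g : ℝ}
    (hy : 0 ≤ y) (p : B) (hg : gram M p q ≤ g) :
    gramQ M (Function.update x q y) ≤ gramQ M x + 2 * y * (x p * g) + 2 * y ^ 2 := by
  rw [gramQ_update hq]
  have h1 := sum_mul_gram_le (M := M) hx hq {p}
  rw [Finset.sum_singleton] at h1
  have h2 := mul_le_mul_of_nonneg_left hg (hx p)
  have := mul_le_mul_of_nonneg_left (h1.trans h2) (mul_nonneg zero_le_two hy)
  linarith

theorem gramQ_single (q : B) (y : ℝ) : gramQ M (Function.update 0 q y) = 2 * y ^ 2 := by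
  rw [gramQ_update (x := (0 : B → ℝ)) rfl]
  simp [gramQ]

end Update

/-- `p 0, …, p k` are the vertices of a path in the Coxeter graph. -/
structure IsChain (M : CoxeterMatrix B) (k : ℕ) (p : ℕ → B) : Prop where
  inj : ∀ i ≤ k, ∀ j ≤ k, p i = p j → i = j
  adj : ∀ i < k, (coxeterGraph M).Adj (p i) (p (i + 1))

theorem IsChain.mono {k l : ℕ} {p : ℕ → B} (h : IsChain M k p) (hl : l ≤ k) : IsChain M l p :=
  ⟨fun i hi j hj => h.inj i (hi.trans hl) j (hj.trans hl), fun i hi => h.adj i (hi.trans_le hl)⟩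

theorem IsChain.shift {k l : ℕ} {p : ℕ → B} (i : ℕ) (h : IsChain M k p) (hl : i + l ≤ k) :
    IsChain M l fun j => p (i + j) :=
  ⟨fun a ha b hb e => by
    have := h.inj _ (by omega) _ (by omega) e
    omega, fun j hj => h.adj (i + j) (by omega)⟩

theorem IsChain.ne {k : ℕ} {p : ℕ → B} (h : IsChain M k p) {i j : ℕ} (hi : i ≤ k) (hj : j ≤ k)
    (hij : i ≠ j) : p i ≠ p j := fun e => hij (h.inj i hi j hj e)

variable [Fintype B] [DecidableEq B]

/-- The vector `(√2/2, 1, …, 1)` on a path starting with a heavy edge. -/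
theorem IsChain.exists_heavy_vector {k : ℕ} {p : ℕ → B} (h : IsChain M (k + 1) p)
    (hp : IsHeavy M (p 0) (p 1)) : ∃ x : B → ℝ, (∀ i, 0 ≤ x i) ∧ x (p (k + 1)) = 1 ∧
      (∀ q, (∀ i ≤ k + 1, q ≠ p i) → x q = 0) ∧ gramQ M x ≤ 1 := by
  have h2 : √2 ^ 2 = 2 := Real.sq_sqrt zero_le_two
  have h0 : 0 ≤ √2 := Real.sqrt_nonneg 2
  induction k with
  | zero =>
    have hne : p 1 ≠ p 0 := hp.ne.symm
    have hx1 := update_nonneg (x := (0 : B → ℝ)) (fun _ => le_rfl) (p 0)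
      (by positivity : 0 ≤ √2 / 2)
    refine ⟨Function.update (Function.update 0 (p 0) (√2 / 2)) (p 1) 1,
      update_nonneg hx1 _ zero_le_one, by simp, ?_, ?_⟩
    · intro q hq
      have hq0 := hq 0 (by omega)
      have hq1 := hq 1 (by omega)
      simp [hq0, hq1]
    -- The value is `1 - 2 + 2 = 1`; every later coordinate `1` contributes at most `-2 + 2 = 0`.
    · have := gramQ_update_le hx1 (q := p 1) (by simp [hne]) zero_le_one (p 0) hp.gram_le
      rw [gramQ_single] at this
      simp only [Function.update_self] at this
      nlinarith
  | succ k ih =>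
    obtain ⟨x, hx, hx1, hx0, hQ⟩ := ih (h.mono (by omega))
    refine ⟨Function.update x (p (k + 2)) 1, update_nonneg hx _ zero_le_one, by simp, ?_, ?_⟩
    · intro q hq
      rw [Function.update_of_ne (hq (k + 2) le_rfl)]
      exact hx0 q fun i hi => hq i (by omega)
    · have := gramQ_update_le hx (q := p (k + 2))
        (hx0 _ fun i hi => h.ne le_rfl (by omega) (by omega)) zero_le_one (p (k + 1))
        (gram_le_of_adj (h.adj (k + 1) (by omega)))
      rw [hx1] at this
      linarith

/-- The vector `(1, …, 1)` on a path. -/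
theorem IsChain.exists_ones_vector {k : ℕ} {p : ℕ → B} (h : IsChain M k p) :
    ∃ x : B → ℝ, (∀ i, 0 ≤ x i) ∧ (∀ i ≤ k, x (p i) = 1) ∧
      (∀ q, (∀ i ≤ k, q ≠ p i) → x q = 0) ∧ gramQ M x ≤ 2 := by
  induction k with
  | zero =>
    refine ⟨Function.update 0 (p 0) 1, update_nonneg (fun _ => le_rfl) _ zero_le_one, ?_, ?_, ?_⟩
    · intro i hi
      obtain rfl : i = 0 := by omega
      simp
    · intro q hq
      simp [hq 0 le_rfl]
    · rw [gramQ_single]; norm_num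
  | succ k ih =>
    obtain ⟨x, hx, hx1, hx0, hQ⟩ := ih (h.mono (by omega))
    refine ⟨Function.update x (p (k + 1)) 1, update_nonneg hx _ zero_le_one, ?_, ?_, ?_⟩
    · intro i hi
      by_cases hik : i = k + 1
      · simp [hik]
      · rw [Function.update_of_ne (h.ne hi le_rfl hik)]
        exact hx1 i (by omega)
    · intro q hq
      rw [Function.update_of_ne (hq (k + 1) le_rfl)]
      exact hx0 q fun i hi => hq i (by omega)
    · have := gramQ_update_le hx (q := p (k + 1))
        (hx0 _ fun i hi => h.ne le_rfl (by omega) (by omega)) zero_le_one (p k)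
        (gram_le_of_adj (h.adj k (by omega)))
      rw [hx1 k le_rfl] at this
      linarith

/-- Positive definiteness of the Gram matrix. -/
def GramPosDef (M : CoxeterMatrix B) : Prop := ∀ x : B → ℝ, x ≠ 0 → 0 < gramQ M x

namespace GramPosDef

variable (hM : GramPosDef M)
include hM

theorem update_false {x : B → ℝ} {q : B} {y : ℝ} (hy : y ≠ 0)
    (hQ : gramQ M (Function.update x q y) ≤ 0) : False := by
  refine (hM _ fun h => hy ?_).not_ge hQ
  simpa using congrFun h q

/-- No path of length at least two begins and ends with a heavy edge. -/
theorem not_two_heavy {k : ℕ} {p : ℕ → B} (h : IsChain M (k + 1) p) (hp : IsHeavy M (p 0) (p 1))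
    {q : B} (hq : ∀ i ≤ k + 1, q ≠ p i) (hpq : IsHeavy M (p (k + 1)) q) : False := by
  obtain ⟨x, hx, hx1, hx0, hQ⟩ := h.exists_heavy_vector hp
  have h2 : √2 ^ 2 = 2 := Real.sq_sqrt zero_le_two
  have h0 : 0 < √2 := Real.sqrt_pos.mpr two_pos
  -- The null vector of affine type `C`: the form is at most `1 - 2 + 1 = 0`.
  refine hM.update_false (x := x) (q := q) (y := √2 / 2) (by positivity) ?_
  have := gramQ_update_le hx (hx0 q hq) (by positivity : 0 ≤ √2 / 2) _ hpq.gram_le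
  rw [hx1] at this
  nlinarith

/-- A path beginning with a heavy edge does not branch. -/
theorem not_branch {k : ℕ} {p : ℕ → B} (h : IsChain M (k + 1) p) (hp : IsHeavy M (p 0) (p 1))
    {q q' : B} (hq : ∀ i ≤ k + 1, q ≠ p i) (hq' : ∀ i ≤ k + 1, q' ≠ p i) (hqq' : q ≠ q')
    (hpq : (coxeterGraph M).Adj (p (k + 1)) q) (hpq' : (coxeterGraph M).Adj (p (k + 1)) q') :
    False := by
  obtain ⟨x, hx, hx1, hx0, hQ⟩ := h.exists_heavy_vector hp
  have hxq := update_nonneg hx q (by norm_num : (0 : ℝ) ≤ 1 / 2)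
  -- The null vector of affine type `B`: each of the two leaves lowers the form by at least `1 / 2`,
  -- starting from at most `1`.
  refine hM.update_false (x := Function.update x q (1 / 2)) (q := q') (y := 1 / 2)
    (by norm_num) ?_
  have h1 := gramQ_update_le hx (hx0 q hq) (by norm_num : (0 : ℝ) ≤ 1 / 2) _ (gram_le_of_adj hpq)
  have h2 := gramQ_update_le hxq (q := q') (by
    rw [Function.update_of_ne hqq'.symm, hx0 q' hq']) (by norm_num : (0 : ℝ) ≤ 1 / 2) _
    (gram_le_of_adj hpq')
  rw [Function.update_of_ne hpq.ne] at h2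
  rw [hx1] at h1 h2
  linarith

/-- There are no cycles. -/
theorem not_cycle {k : ℕ} {p : ℕ → B} (h : IsChain M (k + 2) p)
    (hp : (coxeterGraph M).Adj (p 0) (p (k + 2))) : False := by
  obtain ⟨x, hx, hx1, hx0, hQ⟩ := (h.mono (by omega : k + 1 ≤ k + 2)).exists_ones_vector
  have hq : x (p (k + 2)) = 0 := hx0 _ fun i hi => h.ne le_rfl (by omega) (by omega)
  -- The null vector `(1, …, 1)` of affine type `A`; the last vertex sees both ends of the path, so
  -- the form is at most `2 - 4 + 2`.
  refine hM.update_false (x := x) (q := p (k + 2)) one_ne_zero ?_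
  rw [gramQ_update hq]
  have hne : p 0 ≠ p (k + 1) := h.ne (by omega) (by omega) (by omega)
  have := sum_mul_gram_le (M := M) hx hq {p 0, p (k + 1)}
  rw [Finset.sum_pair hne, hx1 0 (by omega), hx1 (k + 1) le_rfl] at this
  have h1 := gram_le_of_adj hp
  have h2 := gram_le_of_adj (h.adj (k + 1) (by omega))
  rw [add_assoc] at h2
  norm_num at h2
  linarith

/-- The affine diagram of type `F₄` does not occur. -/
theorem not_affine_F {q a b c d : B} (hn : [q, a, b, c, d].Nodup)
    (hqa : (coxeterGraph M).Adj q a) (hab : IsHeavy M a b) (hbc : (coxeterGraph M).Adj b c)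
    (hcd : (coxeterGraph M).Adj c d) : False := by
  simp only [List.nodup_cons, List.mem_cons, not_or, List.not_mem_nil, not_false_eq_true,
    List.nodup_nil, and_true] at hn
  obtain ⟨⟨n1, n2, n3, n4⟩, ⟨n5, n6, n7⟩, ⟨n8, n9⟩, n10⟩ := hn
  have h2 : √2 * √2 = 2 := Real.mul_self_sqrt zero_le_two
  have h0 : 0 < √2 := Real.sqrt_pos.mpr two_pos
  have p1 := update_nonneg (x := (0 : B → ℝ)) (fun _ => le_rfl) q h0.le
  have p2 := update_nonneg p1 a (by positivity : 0 ≤ 2 * √2)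
  have p3 := update_nonneg p2 b (by norm_num : (0 : ℝ) ≤ 3)
  have p4 := update_nonneg p3 c (by norm_num : (0 : ℝ) ≤ 2)
  -- The null vector `(√2, 2√2, 3, 2, 1)`; the successive bounds on the form are `4, 12, 6, 2, 0`.
  refine hM.update_false (q := d) (y := 1) one_ne_zero
    (x := Function.update (Function.update (Function.update (Function.update 0 q √2) a (2 * √2))
      b 3) c 2) ?_
  have e1 := gramQ_single (M := M) q √2
  have e2 := gramQ_update_le p1 (q := a) (by simp [Ne.symm n1]) (by positivity : 0 ≤ 2 * √2) q
    (gram_le_of_adj hqa)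
  have e3 := gramQ_update_le p2 (q := b) (by simp [Ne.symm n2, Ne.symm n5])
    (by norm_num : (0 : ℝ) ≤ 3) a hab.gram_le
  have e4 := gramQ_update_le p3 (q := c) (by simp [Ne.symm n3, Ne.symm n6, Ne.symm n8])
    (by norm_num : (0 : ℝ) ≤ 2) b (gram_le_of_adj hbc)
  have e5 := gramQ_update_le p4 (q := d)
    (by simp [Ne.symm n4, Ne.symm n7, Ne.symm n9, Ne.symm n10])
    (by norm_num : (0 : ℝ) ≤ 1) c (gram_le_of_adj hcd)
  simp only [Function.update_self] at e2 e3 e4 e5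
  nlinarith

/-- The affine diagram of type `G₂` does not occur. -/
theorem not_affine_G {a b c : B} (hca : c ≠ a) (hab : M a b = 0 ∨ 6 ≤ M a b) (hne : a ≠ b)
    (hbc : (coxeterGraph M).Adj b c) : False := by
  have h2 : √3 * √3 = 3 := Real.mul_self_sqrt (by norm_num)
  have h0 : 0 < √3 := Real.sqrt_pos.mpr (by norm_num)
  have hg := gram_le_of_le (by norm_num) hab
  rw [show ((6 : ℕ) : ℝ) = 6 by norm_num, Real.cos_pi_div_six] at hg
  have p1 := update_nonneg (x := (0 : B → ℝ)) (fun _ => le_rfl) a h0.le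
  have p2 := update_nonneg p1 b (by norm_num : (0 : ℝ) ≤ 2)
  -- The null vector `(√3, 2, 1)`, with successive bounds `6, 2, 0`.
  refine hM.update_false (q := c) (y := 1) one_ne_zero
    (x := Function.update (Function.update 0 a √3) b 2) ?_
  have e1 := gramQ_single (M := M) a √3
  have e2 := gramQ_update_le p1 (q := b) (by simp [hne.symm]) (by norm_num : (0 : ℝ) ≤ 2) a hg
  have e3 := gramQ_update_le p2 (q := c) (by simp [hca, hbc.ne.symm])
    (by norm_num : (0 : ℝ) ≤ 1) b (gram_le_of_adj hbc)
  simp only [Function.update_self] at e2 e3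
  nlinarith

/-- A diagram containing a path with at least four vertices that begins with a heavy edge of even
label is of type `BC`. -/
theorem isTypeBC (hirr : IsIrreducible M) {k : ℕ} {p : ℕ → B} (h : IsChain M (k + 3) p)
    (hp : IsHeavy M (p 0) (p 1)) (heven : Even (M (p 0) (p 1))) : IsTypeBC M := by
  let P : ℕ → Prop := fun l => ∃ p : ℕ → B, IsChain M (l + 3) p ∧ IsHeavy M (p 0) (p 1) ∧
    Even (M (p 0) (p 1))
  have hcard : ∀ l, P l → l ≤ Fintype.card B := by
    rintro l ⟨p, hp, -⟩
    have := Fintype.card_le_of_injective (fun i : Fin (l + 4) => p i) fun i j e =>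
      Fin.ext (hp.inj _ (by omega) _ (by omega) e)
    rw [Fintype.card_fin] at this
    omega
  -- A longest such path is shown to be the whole diagram.
  obtain ⟨l, ⟨p, h, hp, heven⟩, hmax⟩ : ∃ l, P l ∧ ∀ l', P l' → l' ≤ l := by
    classical
    refine ⟨Nat.findGreatest P (Fintype.card B),
      Nat.findGreatest_spec (hcard k ⟨p, h, hp, heven⟩) ⟨p, h, hp, heven⟩, fun l' hl' =>
      Nat.le_findGreatest (hcard l' hl') hl'⟩
  have hfour : M (p 0) (p 1) = 4 := by
    by_contra h4
    have hab : M (p 0) (p 1) = 0 ∨ 6 ≤ M (p 0) (p 1) := by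
      rcases hp with h0 | h0
      · exact Or.inl h0
      · obtain ⟨m, hm⟩ := heven
        omega
    exact hM.not_affine_G (h.ne (by omega) (by omega) (by omega : 2 ≠ 0)) hab hp.ne
      (h.adj 1 (by omega))
  have hthree : ∀ i, i + 2 ≤ l + 3 → M (p (i + 1)) (p (i + 2)) = 3 := by
    intro i hi
    refine eq_three_of_adj (h.adj (i + 1) (by omega)) fun hh => ?_
    exact hM.not_two_heavy (h.mono (by omega : i + 1 ≤ l + 3)) hp
      (fun j hj => h.ne hi (by omega) (by omega)) hh
  have htwo : ∀ i j, i + 2 ≤ j → j ≤ l + 3 → M (p i) (p j) = 2 := by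
    intro i j hij hj
    by_contra h2
    obtain ⟨c, rfl⟩ := Nat.exists_eq_add_of_le hij
    refine hM.not_cycle (h.shift i (by omega : i + (c + 2) ≤ l + 3)) ⟨?_, ?_⟩
    · exact h.ne (by omega) (by omega) (by omega)
    · rwa [add_zero, show i + (c + 2) = i + 2 + c by omega]
  have hsurj : ∀ q, ∃ i ≤ l + 3, p i = q := by
    by_contra! hcon
    obtain ⟨q, hq⟩ := hcon
    obtain ⟨W⟩ := hirr.preconnected (p 0) q
    obtain ⟨d, -, ⟨i, hi, hid⟩, hd⟩ := W.exists_boundary_dart {q | ∃ i ≤ l + 3, p i = q}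
      ⟨0, by omega, rfl⟩ (by rintro ⟨i, hi, e⟩; exact hq i hi e)
    have hadj := d.adj
    rw [← hid] at hadj
    generalize d.snd = q' at *
    have hq' : ∀ i ≤ l + 3, q' ≠ p i := fun i hi e => hd ⟨i, hi, e.symm⟩
    -- A further vertex at the heavy end gives affine `F₄`, which is where four vertices are needed;
    -- at an interior vertex it gives a branch; at the other end it extends the longest path.
    rcases Nat.eq_zero_or_pos i with rfl | hi0
    · refine hM.not_affine_F (q := q') (a := p 0) (b := p 1) (c := p 2) (d := p 3) ?_
        hadj.symm hp (h.adj 1 (by omega)) (h.adj 2 (by omega))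
      have hinj : ∀ i ≤ 3, ∀ j ≤ 3, i ≠ j → p i ≠ p j := fun i hi j hj hij =>
        h.ne (by omega) (by omega) hij
      simp [hq' 0, hq' 1, hq' 2, hq' 3, hinj]
    obtain ⟨i, rfl⟩ := Nat.exists_eq_add_of_le' hi0
    rcases hi.lt_or_eq with hlt | heq
    · exact hM.not_branch (h.mono (by omega : i + 1 ≤ l + 3)) hp (fun j hj => hq' j (by omega))
        (q' := p (i + 2)) (fun j hj => h.ne (by omega) (by omega) (by omega))
        (hq' _ (by omega)) hadj (h.adj (i + 1) (by omega))
    · have hn : ∀ j ≤ l + 3, Function.update p (l + 4) q' j = p j := fun j hj =>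
        Function.update_of_ne (by omega) _ _
      have hl : Function.update p (l + 4) q' (l + 4) = q' := Function.update_self _ _ _
      have := hmax (l + 1) ⟨Function.update p (l + 4) q', ⟨?_, ?_⟩, ?_, ?_⟩
      · omega
      · intro a ha b hb e
        by_cases ha' : a = l + 4 <;> by_cases hb' : b = l + 4
        · omega
        · rw [ha', hl, hn b (by omega)] at e
          exact absurd e (hq' b (by omega))
        · rw [hb', hl, hn a (by omega)] at e
          exact absurd e.symm (hq' a (by omega))
        · rw [hn a (by omega), hn b (by omega)] at e
          exact h.inj a (by omega) b (by omega) e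
      · intro a ha
        by_cases ha' : a = l + 3
        · rw [ha', hl, hn _ le_rfl, ← heq]
          exact hadj
        · rw [hn a (by omega), hn (a + 1) (by omega)]
          exact h.adj a (by omega)
      · rwa [hn 0 (by omega), hn 1 (by omega)]
      · rwa [hn 0 (by omega), hn 1 (by omega)]
  -- The numbering is reversed because `CoxeterMatrix.B` has its label `4` on the last edge.
  let f : Fin (l + 4) → B := fun i => p (l + 3 - i)
  have hf : Function.Bijective f := by
    constructor
    · intro i j e
      have := h.inj _ (by omega) _ (by omega) e
      ext
      omega
    · intro q
      obtain ⟨i, hi, rfl⟩ := hsurj q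
      exact ⟨⟨l + 3 - i, by omega⟩, by simp only [f]; congr 1; omega⟩
  refine ⟨l + 4, by omega, (Equiv.ofBijective f hf).symm, ?_⟩
  have hval : ∀ x y, x < y → y ≤ l + 3 →
      M (p x) (p y) = if x = 0 ∧ y = 1 then 4 else if x + 1 = y then 3 else 2 := by
    intro x y hxy hy
    split_ifs with h1 h2
    · obtain ⟨rfl, rfl⟩ := h1
      exact hfour
    · subst h2
      obtain ⟨x, rfl⟩ := Nat.exists_eq_add_of_le' (show 1 ≤ x by omega)
      exact hthree x hy
    · exact htwo x y (by omega) hy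
  ext i j
  change M (p (l + 3 - i)) (p (l + 3 - j)) = CoxeterMatrix.B (l + 4) i j
  simp only [CoxeterMatrix.B, Matrix.of_apply]
  obtain ⟨i, hi⟩ := i
  obtain ⟨j, hj⟩ := j
  rcases lt_trichotomy i j with hij | rfl | hij
  · rw [M.symmetric, hval _ _ (by simp only; omega) (by omega)]
    simp only [Fin.mk.injEq]
    split_ifs <;> first | rfl | omega
  · simp
  · rw [hval _ _ (by simp only; omega) (by omega)]
    simp only [Fin.mk.injEq]
    split_ifs <;> first | rfl | omega

end GramPosDef

end Diagram

/-! ### The simple reflections outside one conjugacy class -/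

section Partition

variable {B : Type v} {M : CoxeterMatrix B}

theorem isHeavy_of_even {i j : B} (h : (coxeterGraph M).Adj i j) (he : Even (M i j)) :
    IsHeavy M i j := by
  have hne2 : M i j ≠ 2 := h.2
  obtain ⟨m, hm⟩ := he
  rw [IsHeavy]
  omega

theorem _root_.SimpleGraph.Walk.IsPath.isChain {i j : B} {W : (coxeterGraph M).Walk i j}
    (hW : W.IsPath) : IsChain M W.length W.getVert :=
  ⟨fun _ ha _ hb e => hW.getVert_injOn ha hb e, fun _ ha => W.adj_getVert_succ ha⟩

variable [Fintype B] [DecidableEq B]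

/-- If all edges between `C` and its complement have even label, then a path between two vertices
outside of `C`, the first one adjacent to `C`, does not meet `C`. -/
theorem GramPosDef.getVert_notMem (hM : GramPosDef M) {C : Set B}
    (hC : ∀ i ∈ C, ∀ j ∉ C, Even (M i j)) {b d : B} (hb : b ∉ C) (hd : d ∉ C)
    {W : (coxeterGraph M).Walk b d} (hW : W.IsPath) {i : ℕ} (hi : i ≤ W.length) :
    W.getVert i ∉ C := by
  intro hiC
  have hheavy : ∀ {x y}, (coxeterGraph M).Adj x y → x ∈ C → y ∉ C → IsHeavy M x y :=
    fun h hx hy => isHeavy_of_even h (hC _ hx _ hy)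
  classical
  have hex : ∃ i, W.getVert i ∈ C := ⟨i, hiC⟩
  -- The path first enters `C` at `s + 1`, and `k` below locates its next exit. Both crossing edges
  -- are heavy, and the segment between them contradicts `not_two_heavy`.
  obtain ⟨i₀, h₀, hmin⟩ : ∃ i₀, W.getVert i₀ ∈ C ∧ ∀ j < i₀, W.getVert j ∉ C :=
    ⟨Nat.find hex, Nat.find_spec hex, fun j hj => Nat.find_min hex hj⟩
  have hi₀ : i₀ ≤ i := not_lt.mp fun h => hmin i h hiC
  obtain ⟨s, rfl⟩ : ∃ s, i₀ = s + 1 := by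
    refine Nat.exists_eq_succ_of_ne_zero ?_
    rintro rfl
    rw [W.getVert_zero] at h₀
    exact hb h₀
  have hex2 : ∃ k, W.getVert (s + 1 + k) ∉ C :=
    ⟨W.length - (s + 1), by rw [Nat.add_sub_cancel' (by omega), W.getVert_length]; exact hd⟩
  obtain ⟨k, hk, hkmin⟩ : ∃ k, W.getVert (s + 1 + k) ∉ C ∧
      ∀ j < k, ¬ W.getVert (s + 1 + j) ∉ C :=
    ⟨Nat.find hex2, Nat.find_spec hex2, fun j hj => Nat.find_min hex2 hj⟩
  have hkle : k ≤ W.length - (s + 1) := not_lt.mp fun h =>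
    hkmin _ h (by rw [Nat.add_sub_cancel' (by omega), W.getVert_length]; exact hd)
  obtain ⟨k, rfl⟩ : ∃ k', k = k' + 1 := by
    refine Nat.exists_eq_succ_of_ne_zero ?_
    rintro rfl
    exact hk h₀
  have hch := hW.isChain
  refine hM.not_two_heavy (hch.shift s (l := k + 1) (by omega))
    (hheavy (hch.adj s (by omega)).symm h₀ (hmin s (by omega))).symm
    (q := W.getVert (s + 1 + (k + 1))) (fun j hj => hch.ne (by omega) (by omega) (by omega)) ?_
  have hkC := not_not.mp (hkmin k (by omega))
  rw [show s + (k + 1) = s + 1 + k by omega]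
  exact hheavy (hch.adj (s + 1 + k) (by omega)) hkC hk

/-- If all edges between `C` and its complement have even label and the diagram is not of type
`BC`, then `C` is empty or its complement is at most one edge, with odd label. -/
theorem GramPosDef.exists_pair (hM : GramPosDef M) (hirr : IsIrreducible M)
    (hBC : ¬ IsTypeBC M) {C : Set B} {r : B} (hr : r ∈ C)
    (hC : ∀ i ∈ C, ∀ j ∉ C, Even (M i j)) :
    ∃ b d, (∀ i, i ∈ C ∨ i = b ∨ i = d) ∧ (b = d ∨ Odd (M b d)) := by
  by_cases hall : ∀ i, i ∈ C
  · exact ⟨r, r, fun i => Or.inl (hall i), Or.inl rfl⟩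
  push Not at hall
  obtain ⟨b', hb'⟩ := hall
  obtain ⟨W⟩ := hirr.preconnected r b'
  obtain ⟨D, -, ha, hb⟩ := W.exists_boundary_dart C hr hb'
  have hadj := D.adj
  generalize D.fst = a at *
  generalize D.snd = b at *
  have heven := hC a ha b hb
  have hab := isHeavy_of_even hadj heven
  -- Otherwise a path of length at least two from `b` to `d` stays outside `C`; prefixed by `a` it
  -- has at least four vertices and starts with a heavy even edge, forcing type `BC`.
  have hnb : ∀ d, d ∉ C → d = b ∨ (coxeterGraph M).Adj b d := by
    intro d hd
    obtain ⟨W', hW'⟩ := (hirr.preconnected b d).exists_isPath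
    have hW'' := hW'.isChain
    have hnot := fun i hi => hM.getVert_notMem hC hb hd hW' (i := i) hi
    by_contra! hcon
    have h0 : W'.length ≠ 0 := fun h => hcon.1 (W'.eq_of_length_eq_zero h).symm
    have h1 : W'.length ≠ 1 := fun h => hcon.2 (W'.adj_of_length_eq_one h)
    obtain ⟨k, hk⟩ : ∃ k, W'.length = k + 2 := Nat.exists_eq_add_of_le' (by omega)
    rw [hk] at hW'' hnot
    have hch : IsChain M (k + 3) fun i => Nat.casesOn i a W'.getVert := by
      constructor
      · rintro (_ | i) hi (_ | j) hj e
        · rfl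
        · exact absurd ha (by rw [show a = W'.getVert j from e]; exact hnot j (by omega))
        · exact absurd ha (by rw [← show W'.getVert i = a from e]; exact hnot i (by omega))
        · rw [hW''.inj i (by omega) j (by omega) e]
      · rintro (_ | i) hi
        · change (coxeterGraph M).Adj a (W'.getVert 0)
          rwa [W'.getVert_zero]
        · exact hW''.adj i (by omega)
    refine hBC (hM.isTypeBC hirr hch ?_ ?_)
    · change IsHeavy M a (W'.getVert 0)
      rwa [W'.getVert_zero]
    · change Even (M a (W'.getVert 0))
      rwa [W'.getVert_zero]
  have hch1 : IsChain M 1 fun i => if i = 0 then a else b := by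
    constructor
    · intro i hi j hj e
      have h1 := hab.ne
      interval_cases i <;> interval_cases j <;> simp_all
    · intro i hi
      obtain rfl : i = 0 := by omega
      exact hadj
  have hout : ∀ q, q ∉ C → q ≠ b → ∀ i ≤ 0 + 1, q ≠ if i = 0 then a else b := by
    intro q hq hqb i hi
    interval_cases i
    · exact fun h => hq (h ▸ ha)
    · exact hqb
  by_cases hex : ∃ d, d ∉ C ∧ d ≠ b
  · obtain ⟨d, hd, hdb⟩ := hex
    have hbd := (hnb d hd).resolve_left hdb
    refine ⟨b, d, fun i => ?_, Or.inr ?_⟩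
    · by_contra! hcon
      obtain ⟨hi, hib, hid⟩ := hcon
      exact hM.not_branch hch1 hab (hout i hi hib) (hout d hd hdb) hid
        ((hnb i hi).resolve_left hib) hbd
    · rw [eq_three_of_adj hbd fun h => hM.not_two_heavy hch1 hab (hout d hd hdb) h]
      exact ⟨1, rfl⟩
  · push Not at hex
    refine ⟨b, b, fun i => ?_, Or.inl rfl⟩
    by_contra! hcon
    exact hcon.2.1 (hex i hcon.1)

end Partition

/-- A two-cocycle of a finite irreducible Coxeter group which is not of type `BC` is cohomologous
to the trivial one if some reflection is regular. -/
theorem cohomologous_trivial_of_isRegular {B : Type v} [Finite B] {M : CoxeterMatrix B}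
    {G : Type u} [Group G] [Finite G] (cs : CoxeterSystem M G) (hirr : IsIrreducible M)
    (hBC : ¬ IsTypeBC M) (ψ : TwoCocycle G) {s : G} (hs : cs.IsReflection s)
    (hreg : ψ.IsRegular s) : ψ.Cohomologous (TwoCocycle.trivial G) := by
  classical
  have := Fintype.ofFinite B
  obtain ⟨w, r, hw⟩ := hs
  have hr : LiftsCommute (TwoCocycle.Extension.proj ψ) (cs.simple r) :=
    (TwoCocycle.Extension.liftsCommute_of_isRegular hreg).conj
      TwoCocycle.Extension.proj_surjective (isConj_iff.mpr ⟨w, hw.symm⟩).symm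
  have hM : GramPosDef M := fun x hx => gramQ_pos cs hirr hx
  -- An odd label makes the two simple reflections conjugate, so labels across the boundary of the
  -- class are even.
  obtain ⟨b, d, hD, hbd⟩ := hM.exists_pair hirr hBC
    (C := {i | IsConj (cs.simple r) (cs.simple i)}) (IsConj.refl (cs.simple r)) (by
      intro i hi j hj
      by_contra hodd
      obtain ⟨k, hk⟩ := Nat.not_even_iff_odd.mp hodd
      refine hj (hi.trans (isConj_iff.mpr ⟨(cs.simple i * cs.simple j) ^ k, ?_⟩))
      rw [conj_pow_of_involutions (cs.simple_mul_simple_self i) (cs.simple_mul_simple_self j), ← hk,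
        cs.simple_mul_simple_pow, one_mul])
  obtain ⟨σ, hσ⟩ := exists_section cs _ TwoCocycle.Extension.proj_surjective
    TwoCocycle.Extension.commute_of_proj_eq_one TwoCocycle.Extension.exists_sqrt r hr b d hD hbd
  exact TwoCocycle.Extension.cohomologous_trivial_of_section σ hσ

/-! ### Roots and reflections of finite Coxeter groups -/

section Roots

open scoped ComplexOrder

open CoxeterSystem

variable {B : Type v} {M : CoxeterMatrix B}

/-- The bilinear form with `rootForm (α_i, v) = coroot i v`. -/
def rootForm (M : CoxeterMatrix B) : LinearMap.BilinForm ℂ (B →₀ ℂ) :=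
  Finsupp.linearCombination ℂ (coroot M)

theorem rootForm_single (i : B) (v : B →₀ ℂ) :
    rootForm M (Finsupp.single i 1) v = coroot M i v := by
  simp [rootForm]

theorem rootForm_apply [Fintype B] (v w : B →₀ ℂ) :
    rootForm M v w = ∑ i, v i * coroot M i w := by
  rw [rootForm, Finsupp.linearCombination_apply, Finsupp.sum_fintype _ _ (by simp)]
  simp

theorem rootForm_symm [Finite B] (v w : B →₀ ℂ) : rootForm M v w = rootForm M w v := by
  have := Fintype.ofFinite B
  simp only [rootForm_apply, coroot_apply, Finset.mul_sum]
  rw [Finset.sum_comm]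
  refine Finset.sum_congr rfl fun i _ => Finset.sum_congr rfl fun j _ => ?_
  rw [gram_symm]
  ring

variable {G : Type u} [Group G] (cs : CoxeterSystem M G)

theorem rootForm_invariant [Finite B] (g : G) (v w : B →₀ ℂ) :
    rootForm M (reflectionRep cs g v) (reflectionRep cs g w) = rootForm M v w := by
  induction g using cs.simple_induction_left generalizing v w with
  | one => simp
  | mul_simple_left g i ih =>
    rw [← ih v w, map_mul, Module.End.mul_apply, Module.End.mul_apply]
    generalize reflectionRep cs g v = v
    generalize reflectionRep cs g w = w
    rw [reflectionRep_simple, reflectionRep_simple]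
    simp only [map_sub, map_smul, LinearMap.sub_apply, LinearMap.smul_apply, rootForm_single,
      coroot_self, smul_eq_mul]
    rw [rootForm_symm v w, rootForm_symm v (Finsupp.single i 1), rootForm_single]
    ring

theorem reflectionRep_conj_simple [Finite B] (g : G) (i : B) (v : B →₀ ℂ) :
    reflectionRep cs (g * cs.simple i * g⁻¹) v =
      v - rootForm M (reflectionRep cs g (Finsupp.single i 1)) v •
        reflectionRep cs g (Finsupp.single i 1) := by
  have h : reflectionRep cs g (reflectionRep cs g⁻¹ v) = v := by
    rw [← Module.End.mul_apply, ← map_mul, mul_inv_cancel, map_one, Module.End.one_apply]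
  rw [map_mul, map_mul, Module.End.mul_apply, Module.End.mul_apply, reflectionRep_simple,
    map_sub, map_smul, h, ← rootForm_single, ← rootForm_invariant cs g, h]

/-- Each further letter applies the recurrence `sin ((x+2)θ) = 2 cos θ sin ((x+1)θ) - sin (xθ)`.
Keeping the factor `sin (π / m)` on the left avoids dividing by a possibly zero sine. -/
theorem sin_smul_alternatingWord (s t : B) (k : ℕ) :
    (Real.sin (Real.pi / M s t) : ℂ) •
      reflectionRep cs (cs.wordProd (alternatingWord s t k)) (Finsupp.single s 1) =
    if Even k then
      (Real.sin ((k + 1) * (Real.pi / M s t)) : ℂ) • Finsupp.single s 1 +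
        (Real.sin (k * (Real.pi / M s t)) : ℂ) • Finsupp.single t 1
    else
      (Real.sin (k * (Real.pi / M s t)) : ℂ) • Finsupp.single s 1 +
        (Real.sin ((k + 1) * (Real.pi / M s t)) : ℂ) • Finsupp.single t 1 := by
  have hrec : ∀ (x : ℝ) (θ : ℝ), Real.sin ((x + 1 + 1) * θ) =
      2 * Real.cos θ * Real.sin ((x + 1) * θ) - Real.sin (x * θ) := by
    intro x θ
    rw [show (x + 1 + 1) * θ = (x + 1) * θ + θ by ring,
      show x * θ = (x + 1) * θ - θ by ring, Real.sin_add, Real.sin_sub]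
    ring
  have hts : gram M t s = gram M s t := gram_symm M t s
  have hg : gram M s t = 2 * -Real.cos (Real.pi / M s t) := rfl
  induction k with
  | zero => simp [alternatingWord]
  | succ k ih =>
    rw [alternatingWord_succ', cs.wordProd_cons, map_mul, Module.End.mul_apply, ← map_smul, ih]
    simp only [Nat.cast_succ]
    generalize hk : (k : ℝ) = x
    generalize Real.pi / (M s t : ℝ) = θ at *
    have hr := congrArg (fun z : ℝ => (z : ℂ)) (hrec x θ)
    by_cases he : Even k
    · have ho : ¬ Even (k + 1) := by simpa [Nat.even_add_one] using he
      simp only [he, ho, if_true, if_false]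
      rw [reflectionRep_simple]
      simp only [map_add, map_smul, coroot_self, coroot_single_eq_gram, hts, hg, smul_eq_mul]
      push_cast at hr ⊢
      rw [hr]
      module
    · have ho : Even (k + 1) := by simpa [Nat.even_add_one] using he
      simp only [he, ho, if_true, if_false]
      rw [reflectionRep_simple]
      simp only [map_add, map_smul, coroot_self, coroot_single_eq_gram, hg, smul_eq_mul]
      push_cast at hr ⊢
      rw [hr]
      module

/-- In the dihedral group generated by `s, t`, the root `α_s` stays positive under alternating words
that are short and end with `t`. -/
theorem exists_nonneg_alternatingWord {s t : B} (hst : s ≠ t) {k : ℕ} (hk : k < M s t) :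
    ∃ a b : ℝ, 0 ≤ a ∧ 0 ≤ b ∧
      reflectionRep cs (cs.wordProd (alternatingWord s t k)) (Finsupp.single s 1) =
        (a : ℂ) • Finsupp.single s 1 + (b : ℂ) • Finsupp.single t 1 := by
  have h := sin_smul_alternatingWord cs s t k
  have hm1 : M s t ≠ 1 := M.off_diagonal s t hst
  have hm : 1 < M s t := by omega
  generalize reflectionRep cs (cs.wordProd (alternatingWord s t k)) (Finsupp.single s 1) = z at *
  generalize M s t = m at *
  have hmR : (1 : ℝ) < m := by exact_mod_cast hm
  have hpi := Real.pi_pos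
  have hpos : 0 < Real.sin (Real.pi / m) :=
    Real.sin_pos_of_pos_of_lt_pi (by positivity) (div_lt_self hpi hmR)
  have hnn : ∀ x : ℝ, 0 ≤ x → x ≤ m → 0 ≤ Real.sin (x * (Real.pi / m)) := by
    intro x h0 hx
    refine Real.sin_nonneg_of_nonneg_of_le_pi (by positivity) ?_
    rw [mul_div_assoc', div_le_iff₀ (by positivity), mul_comm]
    gcongr
  have hkR : (k : ℝ) + 1 ≤ m := by exact_mod_cast hk
  have h1 := hnn k (by positivity) (by linarith)
  have h2 := hnn (k + 1) (by positivity) hkR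
  have hne : ((Real.sin (Real.pi / m) : ℝ) : ℂ) ≠ 0 := by exact_mod_cast hpos.ne'
  have hz : z = ((Real.sin (Real.pi / m) : ℝ) : ℂ)⁻¹ • ((Real.sin (Real.pi / m) : ℝ) : ℂ) • z := by
    rw [smul_smul, inv_mul_cancel₀ hne, one_smul]
  rw [hz, h]
  split_ifs with he
  · refine ⟨(Real.sin (Real.pi / m))⁻¹ * Real.sin ((k + 1) * (Real.pi / m)),
      (Real.sin (Real.pi / m))⁻¹ * Real.sin (k * (Real.pi / m)), by positivity, by positivity, ?_⟩
    rw [smul_add, smul_smul, smul_smul]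
    norm_cast
  · refine ⟨(Real.sin (Real.pi / m))⁻¹ * Real.sin (k * (Real.pi / m)),
      (Real.sin (Real.pi / m))⁻¹ * Real.sin ((k + 1) * (Real.pi / m)), by positivity,
      by positivity, ?_⟩
    rw [smul_add, smul_smul, smul_smul]
    norm_cast

/-- Splitting off an alternating word from the right. -/
theorem exists_mul_alternatingWord {s t : B} {w : G} (hw : ¬ cs.IsRightDescent w s) :
    ∃ v k, w = v * cs.wordProd (alternatingWord s t k) ∧ cs.length w = cs.length v + k ∧
      ¬ cs.IsRightDescent v s ∧ ¬ cs.IsRightDescent v t := by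
  induction hn : cs.length w generalizing w s t with
  | zero =>
    refine ⟨w, 0, by simp [alternatingWord], by simp [hn], hw, ?_⟩
    rw [cs.length_eq_zero_iff.mp hn]
    exact cs.not_isRightDescent_one t
  | succ n ih =>
    by_cases ht : cs.IsRightDescent w t
    · have hlen := (cs.isRightDescent_iff).mp ht
      -- After `t` is removed, `t` is no longer a right descent, so the induction continues with `s`
      -- and `t` interchanged.
      obtain ⟨v, k, hv, hl, h1, h2⟩ := ih (s := t) (t := s) (w := w * cs.simple t)
        ((cs.isRightDescent_iff_not_isRightDescent_mul).mp ht) (by omega)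
      refine ⟨v, k + 1, ?_, by omega, h2, h1⟩
      rw [alternatingWord_succ, cs.wordProd_concat, ← mul_assoc, ← hv,
        cs.simple_mul_simple_cancel_right]
    · exact ⟨w, 0, by simp [alternatingWord], by simp [hn], hw, ht⟩

/-- If `ℓ(w s) > ℓ(w)` then `w α_s` is a nonnegative combination of simple roots. -/
theorem nonneg_of_not_isRightDescent (hfin : ∀ i j, M i j ≠ 0) {w : G} {s : B}
    (hw : ¬ cs.IsRightDescent w s) (j : B) :
    0 ≤ reflectionRep cs w (Finsupp.single s 1) j := by
  induction hn : cs.length w using Nat.strong_induction_on generalizing w s with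
  | _ n ih =>
    by_cases hw1 : w = 1
    · subst hw1
      classical
      rw [map_one, Module.End.one_apply, Finsupp.single_apply]
      split_ifs <;> simp
    obtain ⟨t, ht⟩ := cs.exists_rightDescent_of_ne_one hw1
    have hst : s ≠ t := fun h => hw (h ▸ ht)
    obtain ⟨v, k, hv, hl, h1, h2⟩ := exists_mul_alternatingWord cs (t := t) hw
    have hk0 : k ≠ 0 := by
      rintro rfl
      rw [alternatingWord, cs.wordProd_nil, mul_one] at hv
      exact h2 (hv ▸ ht)
    -- Appending `s` gives an alternating word of length `k + 1`; if that exceeded `m(s,t)` it would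
    -- not be reduced, against `ℓ(ws) = ℓ(w) + 1`.
    have hkm : k < M s t := by
      by_contra hcon
      have hnr := cs.not_isReduced_alternatingWord t s (m := k + 1) (hfin t s)
        (by rw [M.symmetric]; omega)
      have hle := cs.length_wordProd_le (alternatingWord t s (k + 1))
      rw [CoxeterSystem.IsReduced] at hnr
      have hws : w * cs.simple s = v * cs.wordProd (alternatingWord t s (k + 1)) := by
        rw [hv, alternatingWord_succ, cs.wordProd_concat, mul_assoc]
      have hmul := cs.length_mul_le v (cs.wordProd (alternatingWord t s (k + 1)))
      have hlen := (cs.not_isRightDescent_iff).mp hw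
      rw [length_alternatingWord] at hle hnr
      rw [hws] at hlen
      omega
    obtain ⟨a, b, ha, hb, hab⟩ := exists_nonneg_alternatingWord cs hst hkm
    have e1 := ih _ (by omega) h1 rfl
    have e2 := ih _ (by omega) h2 rfl
    rw [hv, map_mul, Module.End.mul_apply, hab, map_add, map_smul, map_smul]
    have ha' : (0 : ℂ) ≤ a := by exact_mod_cast ha
    have hb' : (0 : ℂ) ≤ b := by exact_mod_cast hb
    exact add_nonneg (mul_nonneg ha' e1) (mul_nonneg hb' e2)

/-- For a right descent `i` of `w`, the element `w s_i` sends `α_i` to a nonnegative vector, and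
`s_i α_i = -α_i`. -/
theorem exists_nonpos_of_ne_one (hfin : ∀ i j, M i j ≠ 0) {w : G} (hw : w ≠ 1) :
    ∃ i, ∀ j, reflectionRep cs w (Finsupp.single i 1) j ≤ 0 := by
  obtain ⟨i, hi⟩ := cs.exists_rightDescent_of_ne_one hw
  refine ⟨i, fun j => ?_⟩
  have := nonneg_of_not_isRightDescent cs hfin
    ((cs.isRightDescent_iff_not_isRightDescent_mul).mp hi) j
  rw [map_mul, Module.End.mul_apply, reflectionRep_simple, coroot_self] at this
  have e : Finsupp.single i (1 : ℂ) - (2 : ℂ) • Finsupp.single i 1 = -Finsupp.single i 1 := by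
    rw [two_smul]; abel
  rw [e, map_neg] at this
  simpa using this

theorem _root_.Submodule.exists_generator_of_finrank_eq_one {V : Type*} [AddCommGroup V]
    [Module ℂ V] (S : Submodule ℂ V) (h : Module.finrank ℂ S = 1) :
    ∃ v : S, v ≠ 0 ∧ ∀ w : S, ∃ c : ℂ, c • v = w :=
  finrank_eq_one_iff'.mp h

/-- A linear map of rank one. -/
theorem exists_eq_smul_of_finrank_range (T : (B →₀ ℂ) →ₗ[ℂ] (B →₀ ℂ))
    (hT : Module.finrank ℂ (LinearMap.range T) = 1) :
    ∃ (β : B →₀ ℂ) (f : Module.Dual ℂ (B →₀ ℂ)), β ≠ 0 ∧ β ∈ LinearMap.range T ∧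
      ∀ v, T v = f v • β := by
  obtain ⟨⟨β, hβr⟩, hβ0, hβ⟩ := _root_.Submodule.exists_generator_of_finrank_eq_one _ hT
  have hβne : β ≠ 0 := fun h => hβ0 (Subtype.ext h)
  obtain ⟨j, hj⟩ : ∃ j, β j ≠ 0 := by
    by_contra! h
    exact hβne (Finsupp.ext h)
  refine ⟨β, (β j)⁻¹ • (Finsupp.lapply j ∘ₗ T), hβne, hβr, fun v => ?_⟩
  obtain ⟨c, hc⟩ := hβ ⟨T v, v, rfl⟩
  have hc' : c • β = T v := congrArg Subtype.val hc
  rw [← hc']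
  congr 1
  simp only [LinearMap.smul_apply, LinearMap.comp_apply, Finsupp.lapply_apply, ← hc',
    Finsupp.smul_apply, smul_eq_mul]
  field_simp

/-! ### Stabilizers of points and elements fixing a hyperplane -/

variable [Finite B]

/-- The stabilizer of a point in the fundamental chamber is trivial. -/
theorem eq_one_of_dominant (hfin : ∀ i j, M i j ≠ 0) {u : B →₀ ℂ}
    (hu : ∀ i, 0 < (coroot M i u).re) {w : G} (hw : reflectionRep cs w u = u) : w = 1 := by
  have := Fintype.ofFinite B
  by_contra hne
  obtain ⟨i, hi⟩ := exists_nonpos_of_ne_one cs hfin hne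
  -- The pairing of `u` with `α_i` equals that with `w α_i`, which has nonpositive coordinates; its
  -- real part would be both positive and nonpositive.
  have h1 := rootForm_invariant cs w u (Finsupp.single i 1)
  rw [hw, rootForm_symm u (Finsupp.single i 1), rootForm_single, rootForm_symm,
    rootForm_apply] at h1
  have h2 := hu i
  rw [← h1, Complex.re_sum] at h2
  refine h2.not_ge (Finset.sum_nonpos fun j _ => ?_)
  obtain ⟨hre, him⟩ := Complex.le_def.mp (hi j)
  rw [Complex.mul_re, him]
  simp only [Complex.zero_re, Complex.zero_im, zero_mul, sub_zero] at hre ⊢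
  exact mul_nonpos_of_nonpos_of_nonneg hre (hu j).le

variable [Finite G] (hirr : IsIrreducible M)
include cs hirr

/-- For an infinite label the form would vanish on `α_i + α_j`. -/
theorem label_ne_zero (i j : B) : M i j ≠ 0 := by
  classical
  have := Fintype.ofFinite B
  intro h
  have hij : i ≠ j := by rintro rfl; simp at h
  have hg : gram M i j = -2 := by simp [gram, h]
  refine GramPosDef.update_false (M := M) (fun x hx => gramQ_pos cs hirr hx) (q := j) (y := 1)
    (x := Function.update 0 i 1) one_ne_zero ?_
  have := gramQ_update_le (M := M) (update_nonneg (x := (0 : B → ℝ)) (fun _ => le_rfl) i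
    zero_le_one) (q := j) (by simp [hij.symm]) zero_le_one i hg.le
  rw [gramQ_single] at this
  simp only [Function.update_self] at this
  linarith

/-- The reflection representation is faithful. -/
theorem reflectionRep_injective : Function.Injective (reflectionRep cs) := by
  rw [injective_iff_map_eq_one]
  intro w hw
  obtain ⟨δ, hδ⟩ := exists_coroot_eq cs hirr 1
  exact eq_one_of_dominant cs (label_ne_zero cs hirr) (u := δ) (fun i => by simp [hδ])
    (by rw [hw, Module.End.one_apply])

/-- The stabilizer of a point off all the reflecting hyperplanes is trivial. -/
theorem eq_one_of_generic {v : B →₀ ℂ}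
    (hv : ∀ g i, (rootForm M (reflectionRep cs g (Finsupp.single i 1)) v).re ≠ 0) {w : G}
    (hw : reflectionRep cs w v = v) : w = 1 := by
  obtain ⟨δ, hδ⟩ := exists_coroot_eq cs hirr 1
  -- The orbit point maximizing the pairing with `δ` is dominant: comparison with its image under
  -- `s_i` shows that each coroot has nonnegative real part, and genericity makes it nonzero.
  obtain ⟨g, hg⟩ := Finite.exists_max fun g => (rootForm M δ (reflectionRep cs g v)).re
  have hdom : ∀ i, 0 < (coroot M i (reflectionRep cs g v)).re := by
    intro i
    refine lt_of_le_of_ne ?_ (Ne.symm ?_)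
    · have h := hg (cs.simple i * g)
      simp only [map_mul, Module.End.mul_apply, reflectionRep_simple, map_sub, map_smul] at h
      rw [rootForm_symm δ (Finsupp.single i 1), rootForm_single, hδ] at h
      simpa using h
    · have h := hv g⁻¹ i
      rwa [← rootForm_invariant cs g, ← Module.End.mul_apply, ← map_mul, mul_inv_cancel, map_one,
        Module.End.one_apply, rootForm_single] at h
  have h1 := eq_one_of_dominant cs (label_ne_zero cs hirr) hdom (w := g * w * g⁻¹) (by
    rw [← Module.End.mul_apply, ← map_mul, inv_mul_cancel_right, map_mul, Module.End.mul_apply, hw])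
  simpa using h1

theorem eq_zero_of_rootForm_eq_zero {v : B →₀ ℂ} (hv : ∀ w, rootForm M v w = 0) : v = 0 := by
  classical
  have := Fintype.ofFinite B
  ext j
  obtain ⟨w, hw⟩ := exists_coroot_eq cs hirr (Pi.single j 1)
  have := hv w
  rw [rootForm_apply] at this
  simpa [hw, Pi.single_apply] using this

/-- If a linear form `f ≠ 0` is such that `Id - w` has kernel containing that of `f`, then `ker f`
is orthogonal to a root, unless `w = 1`. -/
theorem exists_root_of_fixed {w : G} (hw : w ≠ 1) (f : Module.Dual ℂ (B →₀ ℂ))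
    (hf : ∀ v, f v = 0 → reflectionRep cs w v = v) :
    ∃ g i, ∀ v, f v = 0 → rootForm M (reflectionRep cs g (Finsupp.single i 1)) v = 0 := by
  by_contra! hcon
  -- Genericity concerns real parts, so `ker f` is viewed over `ℝ`. Finitely many proper subspaces
  -- do not cover it; if one of them is everything, multiplication by `I` makes the imaginary part
  -- vanish too.
  let K : Submodule ℝ (B →₀ ℂ) := (LinearMap.ker f).restrictScalars ℝ
  let P : G × B → Subspace ℝ K := fun q => LinearMap.ker
    (Complex.reLm ∘ₗ (rootForm M (reflectionRep cs q.1 (Finsupp.single q.2 1))).restrictScalars ℝ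
      ∘ₗ K.subtype)
  have hP : ⋃ q, (P q : Set K) ≠ Set.univ := by
    intro hcov
    obtain ⟨⟨g, i⟩, hgi⟩ := Subspace.exists_eq_top_of_iUnion_eq_univ hcov
    obtain ⟨v, hv, hne⟩ := hcon g i
    have hmem : ∀ x, f x = 0 →
        (rootForm M (reflectionRep cs g (Finsupp.single i 1)) x).re = 0 := by
      intro x hx
      have : (⟨x, hx⟩ : K) ∈ P (g, i) := by rw [hgi]; trivial
      exact LinearMap.mem_ker.mp this
    refine hne (Complex.ext (hmem v hv) ?_)
    have := hmem (Complex.I • v) (by rw [map_smul, hv, smul_zero])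
    rw [map_smul] at this
    simpa using this
  obtain ⟨⟨x, hx⟩, hxP⟩ := (Set.ne_univ_iff_exists_notMem _).mp hP
  rw [Set.mem_iUnion, not_exists] at hxP
  exact hw (eq_one_of_generic cs hirr (v := x) (fun g i h => hxP (g, i) h) (hf x hx))

/-- The elements that act by reflections are the reflections of the Coxeter group. -/
theorem isReflection_of_finrank {w : G}
    (hw : Module.finrank ℂ (LinearMap.range (LinearMap.id - reflectionRep cs w)) = 1) :
    cs.IsReflection w := by
  set T : (B →₀ ℂ) →ₗ[ℂ] (B →₀ ℂ) := LinearMap.id - reflectionRep cs w with hT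
  obtain ⟨β, f, hβne, hβr, hTf⟩ := exists_eq_smul_of_finrank_range T hw
  have hwf : ∀ v, reflectionRep cs w v = v - f v • β := by
    intro v
    rw [← hTf, hT]
    simp
  obtain ⟨v₁, hv₁⟩ := hβr
  have hfv₁ : f v₁ ≠ 0 := by
    intro h
    rw [hTf, h, zero_smul] at hv₁
    exact hβne hv₁.symm
  have hw1 : w ≠ 1 := by
    rintro rfl
    refine hβne ?_
    rw [← hv₁, hT, map_one]
    simp
  obtain ⟨g, i, hgi⟩ := exists_root_of_fixed cs hirr hw1 f fun v hv => by
    rw [hwf, hv, zero_smul, sub_zero]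
  set α := reflectionRep cs g (Finsupp.single i 1) with hα
  have hαα : rootForm M α α = 2 := by
    rw [hα, rootForm_invariant, rootForm_single, coroot_self]
  -- Both `α` and `β` are orthogonal to the hyperplane `ker f`, hence proportional by nondegeneracy.
  have hβorth : ∀ h, f h = 0 → rootForm M β h = 0 := by
    intro h hh
    have key := rootForm_invariant cs w h v₁
    rw [hwf, hh, zero_smul, sub_zero, hwf, map_sub, map_smul, sub_eq_self, smul_eq_mul] at key
    rw [rootForm_symm]
    exact (mul_eq_zero.mp key).resolve_left hfv₁
  have hprop : ∀ γ, (∀ h, f h = 0 → rootForm M γ h = 0) →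
      ∀ v, rootForm M γ v = rootForm M γ v₁ / f v₁ * f v := by
    intro γ hγ v
    have := hγ (v - (f v / f v₁) • v₁) (by
      rw [map_sub, map_smul, smul_eq_mul, div_mul_cancel₀ _ hfv₁, sub_self])
    rw [map_sub, map_smul, sub_eq_zero, smul_eq_mul] at this
    rw [this]
    ring
  have hαf := hprop α hgi
  have hβf := hprop β hβorth
  set a := rootForm M α v₁ / f v₁
  set b := rootForm M β v₁ / f v₁
  have ha : a ≠ 0 := by
    intro h
    rw [hαf, h, zero_mul] at hαα
    exact two_ne_zero hαα.symm
  have hβα : β = (b / a) • α := by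
    rw [← sub_eq_zero]
    refine eq_zero_of_rootForm_eq_zero cs hirr fun v => ?_
    rw [map_sub, map_smul, LinearMap.sub_apply, LinearMap.smul_apply, hαf, hβf, smul_eq_mul]
    field_simp
    ring
  have hb : b ≠ 0 := by
    rintro h
    rw [h, zero_div, zero_smul] at hβα
    exact hβne hβα
  set κ := b / (a * a) with hκ
  have hwα : ∀ v, reflectionRep cs w v = v - (κ * rootForm M α v) • α := by
    intro v
    rw [hwf, hβα, smul_smul, hαf, hκ]
    congr 2
    field_simp
  -- Since `w α = (1 - 2κ) α`, preservation of the norm of `α` forces `κ (κ - 1) = 0`.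
  have hκ1 : κ = 1 := by
    have key := rootForm_invariant cs w α α
    rw [hwα, hαα] at key
    simp only [map_sub, map_smul, LinearMap.sub_apply, LinearMap.smul_apply, hαα,
      smul_eq_mul] at key
    have hκ0 : κ ≠ 0 := div_ne_zero hb (mul_ne_zero ha ha)
    have : κ * (κ - 1) = 0 := by linear_combination key / 8
    exact sub_eq_zero.mp ((mul_eq_zero.mp this).resolve_left hκ0)
  refine ⟨g, i, reflectionRep_injective cs hirr (LinearMap.ext fun v => ?_)⟩
  rw [reflectionRep_conj_simple, hwα, hκ1, one_mul]

end Roots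

/-! ### The universal property of twisted semidirect products -/

namespace TwistedSmash

variable {G : Type u} [Group G] {A : Type v} [Ring A] [Algebra ℂ A]
  (α : G →* (A →ₐ[ℂ] A)) (ψ : TwoCocycle G)

theorem incl_eq (a : A) : incl α ψ a = single α ψ 1 (((ψ 1 1)⁻¹ : ℂˣ) • a) := rfl

theorem incl_mul_of (a : A) (g : G) : incl α ψ a * of α ψ g = single α ψ g a := by
  rw [incl_eq, of, single_mul_single, one_mul, map_one, mul_one, ψ.map_one_left, Units.smul_def,
    smul_smul, Units.mul_inv, one_smul]

theorem of_mul_incl (a : A) (g : G) : of α ψ g * incl α ψ a = incl α ψ (α g a) * of α ψ g := by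
  rw [incl_mul_of, incl_eq, of, single_mul_single, mul_one, one_mul, ψ.map_one_right,
    Units.smul_def, map_smul (α g), smul_smul, Units.mul_inv, one_smul]

theorem of_mul_of (g h : G) : of α ψ g * of α ψ h = (ψ g h : ℂ) • of α ψ (g * h) := by
  rw [of, of, single_mul_single, map_one, one_mul, map_smul, of]

theorem of_one : of α ψ 1 = (ψ 1 1 : ℂ) • (1 : TwistedSmash α ψ) := by
  rw [one_eq, Units.smul_def, map_smul, smul_smul, Units.mul_inv, one_smul, of]

variable {α ψ}
variable {R : Type w} [Ring R] [Algebra ℂ R]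

/-- The algebra homomorphism out of `A ⋊ ℂ_ψ G` given by compatible maps on `A` and on `G`. -/
def lift (f : A →ₐ[ℂ] R) (T : G → R) (hone : T 1 = (ψ 1 1 : ℂ) • (1 : R))
    (hmul : ∀ g h, T g * T h = (ψ g h : ℂ) • T (g * h))
    (hcomm : ∀ g a, T g * f a = f (α g a) * T g) : TwistedSmash α ψ →ₐ[ℂ] R :=
  AlgHom.ofLinearMap (lsum α ψ fun g => LinearMap.mulRight ℂ (T g) ∘ₗ f.toLinearMap)
    (by
      rw [one_eq, lsum_single, Units.smul_def]
      simp [hone, smul_smul])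
    (by
      intro x y
      induction x using TwistedSmash.induction with
      | zero => simp
      | add x x' hx hx' => rw [add_mul, map_add, map_add, add_mul, hx, hx']
      | single g a =>
        induction y using TwistedSmash.induction with
        | zero => simp
        | add y y' hy hy' => rw [mul_add, map_add, map_add, mul_add, hy, hy']
        | single h b =>
          rw [single_mul_single, lsum_single, lsum_single, lsum_single]
          simp only [LinearMap.comp_apply, AlgHom.toLinearMap_apply, LinearMap.mulRight_apply,
            map_smul, map_mul]
          rw [mul_assoc (f a) (T g), ← mul_assoc (T g), hcomm, mul_assoc (f (α g b)) (T g), hmul,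
            mul_smul_comm, mul_smul_comm, mul_assoc])

section Lift

variable {f : A →ₐ[ℂ] R} {T : G → R} {hone : T 1 = (ψ 1 1 : ℂ) • (1 : R)}
  {hmul : ∀ g h, T g * T h = (ψ g h : ℂ) • T (g * h)}
  {hcomm : ∀ g a, T g * f a = f (α g a) * T g}

theorem lift_single (g : G) (a : A) :
    lift f T hone hmul hcomm (single α ψ g a) = f a * T g :=
  lsum_single α ψ _ g a

theorem lift_of (g : G) : lift f T hone hmul hcomm (of α ψ g) = T g := by
  rw [of, lift_single, map_one, one_mul]

theorem lift_incl (a : A) : lift f T hone hmul hcomm (incl α ψ a) = f a := by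
  rw [incl_eq, lift_single, hone, Units.smul_def, map_smul, mul_smul_comm, mul_one, smul_smul,
    Units.mul_inv, one_smul]

end Lift

theorem algHom_ext {f f' : TwistedSmash α ψ →ₐ[ℂ] R}
    (hA : f.comp (incl α ψ) = f'.comp (incl α ψ)) (hG : ∀ g, f (of α ψ g) = f' (of α ψ g)) :
    f = f' := by
  ext x
  induction x using TwistedSmash.induction with
  | zero => rw [map_zero, map_zero]
  | add x y hx hy => rw [map_add, map_add, hx, hy]
  | single g a =>
    rw [← incl_mul_of, map_mul, map_mul, hG]
    congr 1
    exact AlgHom.congr_fun hA a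

end TwistedSmash

/-! ### The reflection algebra when there are no regular reflections -/

namespace SymplecticRep

variable {G : Type u} [Group G] [Finite G] {U : Type v} [AddCommGroup U] [Module ℂ U]
  (V : SymplecticRep G U) (ψ : TwoCocycle G) (t : ℂ) (c : V.regularReflections ψ → ℂ)

/-- The canonical map `U → H_{t,c}(G,U,ψ)`, as a linear map. -/
def vecHom : U →ₗ[ℂ] V.ReflectionAlgebra ψ t c :=
  (V.quotMap ψ t c).toLinearMap ∘ₗ
    (TwistedSmash.incl (tensorAction V.ρ) ψ).toLinearMap ∘ₗ TensorAlgebra.ι ℂ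

theorem vecHom_apply (x : U) : V.vecHom ψ t c x = V.vec ψ t c x := rfl

theorem grp_one : V.grp ψ t c 1 = (ψ 1 1 : ℂ) • (1 : V.ReflectionAlgebra ψ t c) := by
  rw [grp, TwistedSmash.of_one, map_smul, map_one]

theorem grp_mul_grp (g h : G) :
    V.grp ψ t c g * V.grp ψ t c h = (ψ g h : ℂ) • V.grp ψ t c (g * h) := by
  rw [grp, grp, ← map_mul, TwistedSmash.of_mul_of, map_smul, grp]

theorem grp_mul_vec (g : G) (x : U) :
    V.grp ψ t c g * V.vec ψ t c x = V.vec ψ t c (V.ρ g x) * V.grp ψ t c g := by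
  rw [grp, vec, ← map_mul, TwistedSmash.of_mul_incl, map_mul, vec]
  simp [tensorAction]

variable (hS : V.regularReflections ψ = ∅)
include hS

theorem relator_eq (x y : U) : V.relator ψ t c x y =
    TwistedSmash.incl _ _ (TensorAlgebra.ι ℂ y * TensorAlgebra.ι ℂ x
      - TensorAlgebra.ι ℂ x * TensorAlgebra.ι ℂ y) - algebraMap ℂ _ (t * V.ω x y) := by
  have : IsEmpty (V.regularReflections ψ) := Set.isEmpty_coe_sort.mpr hS
  rw [relator, finsum_of_isEmpty, sub_zero, Algebra.algebraMap_eq_smul_one]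

theorem vec_comm (x y : U) : V.vec ψ t c y * V.vec ψ t c x - V.vec ψ t c x * V.vec ψ t c y =
    algebraMap ℂ _ (t * V.ω x y) := by
  have h : V.quotMap ψ t c (V.relator ψ t c x y) = V.quotMap ψ t c 0 :=
    RingQuot.mkAlgHom_rel ℂ (Rel.intro x y)
  rw [V.relator_eq ψ t c hS, map_zero, map_sub, AlgHom.commutes, sub_eq_zero] at h
  rw [← h]
  simp only [vec, map_sub, map_mul]

/-- If there are no regular reflections and `A` is the quotient of `TU` by the relations
`y ⊗ x - x ⊗ y = t ω(x,y)`, then the reflection algebra is `A ⋊ ℂ_ψ G`. -/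
theorem exists_equiv_smash {A : Type v} [Ring A] [Algebra ℂ A] (α : G →* (A →ₐ[ℂ] A))
    (i : U →ₗ[ℂ] A) (hα : ∀ g x, α g (i x) = i (V.ρ g x))
    (hi : ∀ x y, i y * i x - i x * i y = algebraMap ℂ A (t * V.ω x y))
    (hsurj : Function.Surjective (TensorAlgebra.lift ℂ i))
    (j : A →ₐ[ℂ] V.ReflectionAlgebra ψ t c) (hj : ∀ x, j (i x) = V.vec ψ t c x) :
    ∃ e : V.ReflectionAlgebra ψ t c ≃ₐ[ℂ] TwistedSmash α ψ,
      (∀ x, e (V.vec ψ t c x) = TwistedSmash.incl _ _ (i x)) ∧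
      (∀ g, e (V.grp ψ t c g) = TwistedSmash.of _ _ g) := by
  have hcomm₀ : ∀ g a, TwistedSmash.of α ψ g *
      (TwistedSmash.incl α ψ).comp (TensorAlgebra.lift ℂ i) a =
      (TwistedSmash.incl α ψ).comp (TensorAlgebra.lift ℂ i) (tensorAction V.ρ g a) *
        TwistedSmash.of α ψ g := by
    intro g a
    have : (α g).comp (TensorAlgebra.lift ℂ i) =
        (TensorAlgebra.lift ℂ i).comp (tensorAction V.ρ g) := by
      ext x
      simp [hα, tensorAction]
    rw [AlgHom.comp_apply, AlgHom.comp_apply, ← AlgHom.comp_apply _ (tensorAction V.ρ g), ← this,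
      TwistedSmash.of_mul_incl, AlgHom.comp_apply]
  let F₀ : V.TensorSmash ψ →ₐ[ℂ] TwistedSmash α ψ :=
    TwistedSmash.lift ((TwistedSmash.incl α ψ).comp (TensorAlgebra.lift ℂ i))
      (TwistedSmash.of α ψ) (TwistedSmash.of_one α ψ) (TwistedSmash.of_mul_of α ψ) hcomm₀
  have hF₀ : ∀ ⦃x y⦄, V.Rel ψ t c x y → F₀ x = F₀ y := by
    rintro _ _ ⟨x, y⟩
    rw [V.relator_eq ψ t c hS, map_zero, map_sub, AlgHom.commutes, TwistedSmash.lift_incl,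
      AlgHom.comp_apply, map_sub (TensorAlgebra.lift ℂ i), map_mul, map_mul,
      TensorAlgebra.lift_ι_apply, TensorAlgebra.lift_ι_apply, hi, AlgHom.commutes, sub_self]
  let F : V.ReflectionAlgebra ψ t c →ₐ[ℂ] TwistedSmash α ψ := RingQuot.liftAlgHom ℂ ⟨F₀, hF₀⟩
  have hF : ∀ x, F (V.quotMap ψ t c x) = F₀ x := fun x =>
    RingQuot.liftAlgHom_mkAlgHom_apply ℂ F₀ hF₀ x
  have hFvec : ∀ x, F (V.vec ψ t c x) = TwistedSmash.incl _ _ (i x) := fun x => by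
    rw [vec, hF, TwistedSmash.lift_incl, AlgHom.comp_apply, TensorAlgebra.lift_ι_apply]
  have hFgrp : ∀ g, F (V.grp ψ t c g) = TwistedSmash.of _ _ g := fun g => by
    rw [grp, hF, TwistedSmash.lift_of]
  -- Because `TU` surjects onto `A`, it suffices to check this on vectors, where it is the smash
  -- relation.
  have hcomm : ∀ g a, V.grp ψ t c g * j a = j (α g a) * V.grp ψ t c g := by
    intro g a
    obtain ⟨a, rfl⟩ := hsurj a
    induction a using TensorAlgebra.induction with
    | algebraMap r => simp only [AlgHom.commutes, Algebra.commutes]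
    | ι x => rw [TensorAlgebra.lift_ι_apply, hα, hj, hj, grp_mul_vec]
    | add a b ha hb => simp only [map_add, mul_add, add_mul, ha, hb]
    | mul a b ha hb => simp only [map_mul]; rw [← mul_assoc, ha, mul_assoc, hb, ← mul_assoc]
  let K : TwistedSmash α ψ →ₐ[ℂ] V.ReflectionAlgebra ψ t c :=
    TwistedSmash.lift j (V.grp ψ t c) (V.grp_one ψ t c) (V.grp_mul_grp ψ t c) hcomm
  have h1 : F.comp K = AlgHom.id ℂ _ := by
    refine TwistedSmash.algHom_ext (AlgHom.ext fun a => ?_) fun g => ?_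
    · obtain ⟨a, rfl⟩ := hsurj a
      have : ((F.comp K).comp (TwistedSmash.incl α ψ)).comp (TensorAlgebra.lift ℂ i) =
          ((AlgHom.id ℂ _).comp (TwistedSmash.incl α ψ)).comp (TensorAlgebra.lift ℂ i) := by
        ext x
        simp only [LinearMap.comp_apply, AlgHom.toLinearMap_apply, AlgHom.comp_apply,
          TensorAlgebra.lift_ι_apply, AlgHom.id_apply, K]
        rw [TwistedSmash.lift_incl, hj, hFvec]
      exact AlgHom.congr_fun this a
    · rw [AlgHom.comp_apply, TwistedSmash.lift_of, hFgrp, AlgHom.id_apply]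
  have h2 : K.comp F = AlgHom.id ℂ _ := by
    refine RingQuot.ringQuot_ext' _ _ _ (TwistedSmash.algHom_ext ?_ fun g => ?_)
    · ext x
      change K (F (V.vec ψ t c x)) = V.vec ψ t c x
      rw [hFvec, TwistedSmash.lift_incl, hj]
    · change K (F (V.grp ψ t c g)) = V.grp ψ t c g
      rw [hFgrp, TwistedSmash.lift_of]
  exact ⟨AlgEquiv.ofAlgHom F K h1 h2, hFvec, hFgrp⟩

theorem exists_equiv_weylSmash : ∃ e : V.ReflectionAlgebra ψ t c ≃ₐ[ℂ] V.WeylSmash t ψ,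
    (∀ x, e (V.vec ψ t c x) = TwistedSmash.incl _ _ (V.weylι t x)) ∧
    (∀ g, e (V.grp ψ t c g) = TwistedSmash.of _ _ g) := by
  have hlift : TensorAlgebra.lift ℂ (V.weylι t) = RingQuot.mkAlgHom ℂ (V.WeylRel t) := by
    ext x
    simp [weylι]
  have hj : ∀ ⦃x y⦄, V.WeylRel t x y →
      TensorAlgebra.lift ℂ (V.vecHom ψ t c) x = TensorAlgebra.lift ℂ (V.vecHom ψ t c) y := by
    rintro _ _ ⟨x, y⟩
    simp only [map_sub, map_mul, TensorAlgebra.lift_ι_apply, AlgHom.commutes, vecHom_apply]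
    rw [V.vec_comm ψ t c hS, map_mul]
  refine V.exists_equiv_smash ψ t c hS (V.weylAction t) (V.weylι t) (fun g x => ?_)
    (V.weylι_comm t) (hlift ▸ RingQuot.mkAlgHom_surjective ℂ _)
    (RingQuot.liftAlgHom ℂ ⟨TensorAlgebra.lift ℂ (V.vecHom ψ t c), hj⟩) fun x => ?_
  · simp [weylAction, weylι]
  · simp [weylι, vecHom_apply]

theorem exists_equiv_symSmash (c : V.regularReflections ψ → ℂ) :
    ∃ e : V.ReflectionAlgebra ψ 0 c ≃ₐ[ℂ] V.SymSmash ψ,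
    (∀ x, e (V.vec ψ 0 c x) = TwistedSmash.incl _ _ (SymmetricAlgebra.ι ℂ _ x)) ∧
    (∀ g, e (V.grp ψ 0 c g) = TwistedSmash.of _ _ g) := by
  have hlift : TensorAlgebra.lift ℂ (SymmetricAlgebra.ι ℂ U) = SymmetricAlgebra.algHom ℂ U := by
    ext x
    simp [SymmetricAlgebra.ι]
  -- At `t = 0` the images of vectors commute, so the map from `TU` factors through the symmetric
  -- algebra.
  have hj : TensorAlgebra.symRingCon ℂ U ≤
      RingCon.ker (TensorAlgebra.lift ℂ (V.vecHom ψ 0 c)).toRingHom := by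
    refine RingCon.ringConGen_le.2 ?_
    rintro _ _ ⟨x, y⟩
    have h := V.vec_comm ψ 0 c hS y x
    rw [zero_mul, map_zero, sub_eq_zero] at h
    simpa [RingCon.ker_apply, vecHom_apply] using h
  refine V.exists_equiv_smash ψ 0 c hS (symAction V.ρ) (SymmetricAlgebra.ι ℂ U) (fun g x => ?_)
    (fun x y => ?_) (hlift ▸ SymmetricAlgebra.algHom_surjective ℂ U)
    (RingCon.liftₐ _ (TensorAlgebra.lift ℂ (V.vecHom ψ 0 c)) hj) fun x => ?_
  · simp [symAction]
  · rw [mul_comm, sub_self, zero_mul, map_zero]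
  · change TensorAlgebra.lift ℂ (V.vecHom ψ 0 c) (TensorAlgebra.ι ℂ x) = _
    rw [TensorAlgebra.lift_ι_apply, vecHom_apply]

end SymplecticRep

/-! ### Symplectic reflections of `𝔥 ⊕ 𝔥*` -/

section Rank

variable {V : Type v} [AddCommGroup V] [Module ℂ V] [Module.Finite ℂ V]

theorem finrank_range_prodMap {W : Type w} [AddCommGroup W] [Module ℂ W] [Module.Finite ℂ W]
    (f : V →ₗ[ℂ] V) (g : W →ₗ[ℂ] W) :
    Module.finrank ℂ (LinearMap.range (f.prodMap g)) =
      Module.finrank ℂ (LinearMap.range f) + Module.finrank ℂ (LinearMap.range g) := by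
  have h : LinearMap.range (f.prodMap g) =
      LinearMap.range ((LinearMap.range f).subtype.prodMap (LinearMap.range g).subtype) := by
    ext ⟨x, y⟩
    simp
  rw [h, LinearMap.finrank_range_of_inj, Module.finrank_prod]
  exact Function.Injective.prodMap Subtype.val_injective Subtype.val_injective

variable {G : Type u} [Group G] (ρ : Representation ℂ G V)

/-- From `Id - g⁻¹ = -g⁻¹ (Id - g)`. Applied to `g` and to `g⁻¹` it gives equal ranks, which is
needed because `g` acts on `𝔥*` by the transpose of `g⁻¹`. -/
theorem finrank_range_id_sub_inv_le (g : G) :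
    Module.finrank ℂ (LinearMap.range (LinearMap.id - ρ g⁻¹)) ≤
      Module.finrank ℂ (LinearMap.range (LinearMap.id - ρ g)) := by
  have h : LinearMap.id - ρ g⁻¹ = (-ρ g⁻¹) ∘ₗ (LinearMap.id - ρ g) := by
    ext x
    have : ρ g⁻¹ (ρ g x) = x := by
      rw [← Module.End.mul_apply, ← map_mul, inv_mul_cancel, map_one, Module.End.one_apply]
    simp [this]
  rw [h, LinearMap.range_comp]
  exact Submodule.finrank_map_le _ _

theorem finrank_range_idSub_doubled (g : G) :
    Module.finrank ℂ (LinearMap.range ((doubled ρ).idSub g)) =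
      2 * Module.finrank ℂ (LinearMap.range (LinearMap.id - ρ g)) := by
  have h : (doubled ρ).idSub g =
      (LinearMap.id - ρ g).prodMap (LinearMap.dualMap (LinearMap.id - ρ g⁻¹)) := by
    refine LinearMap.ext fun ⟨x, y⟩ => Prod.ext rfl (LinearMap.ext fun z => ?_)
    simp [SymplecticRep.idSub, doubled, Representation.prod, Representation.dual_apply,
      Module.Dual.transpose_apply]
  have hinv := finrank_range_id_sub_inv_le ρ g⁻¹
  rw [inv_inv] at hinv
  rw [h, finrank_range_prodMap, LinearMap.finrank_range_dualMap_eq_finrank_range,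
    (finrank_range_id_sub_inv_le ρ g).antisymm hinv, two_mul]

end Rank

/-- The symplectic reflections of `𝔥 ⊕ 𝔥*` are the reflections of the Coxeter group. -/
theorem isReflection_of_mem_reflections {B : Type v} [Finite B] {M : CoxeterMatrix B} {G : Type u}
    [Group G] [Finite G] (cs : CoxeterSystem M G) (hirr : IsIrreducible M) {g : G}
    (hg : g ∈ (cherednikRep cs).reflections) : cs.IsReflection g := by
  refine isReflection_of_finrank cs hirr ?_
  have h : Module.finrank ℂ (LinearMap.range ((doubled (reflectionRep cs)).idSub g)) = 2 := hg
  rw [finrank_range_idSub_doubled] at h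
  omega

end TwistedCherednik

end

theorem mainTheorem4 {B : Type*} [Finite B] {M : CoxeterMatrix B} {G : Type*} [Group G] [Finite G]
    (cs : CoxeterSystem M G) (hirr : TwistedCherednik.IsIrreducible M)
    (hBC : ¬ TwistedCherednik.IsTypeBC M) (ψ : TwistedCherednik.TwoCocycle G) :
    (∀ s : G, cs.IsReflection s → ψ.IsRegular s →
      ψ.Cohomologous (TwistedCherednik.TwoCocycle.trivial G)) ∧
    (¬ ψ.Cohomologous (TwistedCherednik.TwoCocycle.trivial G) →
      (∀ (t : ℂ) (c : (TwistedCherednik.cherednikRep cs).regularReflections ψ → ℂ),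
        ∃ e : (TwistedCherednik.cherednikRep cs).ReflectionAlgebra ψ t c ≃ₐ[ℂ]
            (TwistedCherednik.cherednikRep cs).WeylSmash t ψ,
          (∀ x, e ((TwistedCherednik.cherednikRep cs).vec ψ t c x) =
            TwistedCherednik.TwistedSmash.incl _ _
              ((TwistedCherednik.cherednikRep cs).weylι t x)) ∧
          (∀ g, e ((TwistedCherednik.cherednikRep cs).grp ψ t c g) =
            TwistedCherednik.TwistedSmash.of _ _ g)) ∧
      (∀ c : (TwistedCherednik.cherednikRep cs).regularReflections ψ → ℂ,
        ∃ e : (TwistedCherednik.cherednikRep cs).ReflectionAlgebra ψ 0 c ≃ₐ[ℂ]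
            (TwistedCherednik.cherednikRep cs).SymSmash ψ,
          (∀ x, e ((TwistedCherednik.cherednikRep cs).vec ψ 0 c x) =
            TwistedCherednik.TwistedSmash.incl _ _ (SymmetricAlgebra.ι ℂ _ x)) ∧
          (∀ g, e ((TwistedCherednik.cherednikRep cs).grp ψ 0 c g) =
            TwistedCherednik.TwistedSmash.of _ _ g))) := by
  have h1 : ∀ s : G, cs.IsReflection s → ψ.IsRegular s →
      ψ.Cohomologous (TwistedCherednik.TwoCocycle.trivial G) := fun s hs hreg =>
    TwistedCherednik.cohomologous_trivial_of_isRegular cs hirr hBC ψ hs hreg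
  refine ⟨h1, fun hψ => ?_⟩
  have hS : (TwistedCherednik.cherednikRep cs).regularReflections ψ = ∅ :=
    Set.eq_empty_iff_forall_notMem.mpr fun s hs =>
      hψ (h1 s (TwistedCherednik.isReflection_of_mem_reflections cs hirr hs.1) hs.2)
  exact ⟨fun t c => (TwistedCherednik.cherednikRep cs).exists_equiv_weylSmash ψ t c hS,
    fun c => (TwistedCherednik.cherednikRep cs).exists_equiv_symSmash ψ hS c⟩
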